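/- Consider the Cramér–Lundberg risk model without diffusion, $X_t=x+ct-\sum_{i=1}^{N_t}\xi_i$, with premium rate $c>0$, where $N$ is a Poisson process of intensity $\lambda>0$ and the claims $\xi_i$ are i.i.d., independent of $N$, with values in $(0,\infty)$ and density $f$. Let $q>0$ be the discount rate, $k\ge 1$ the proportional cost of capital injections, $P\in\mathbb R$ the penalty at bankruptcy, $a>0$ and $b\ge 0$. The $(-a,0,b)$ policy pays as dividends everything above the barrier $b$ (at once if the surplus exceeds $b$, and at rate $c$ while the surplus is at $b$), covers at once by a capital injection every deficit of size at most $a$, bringing the surplus back to $0$, and declares bankruptcy at the first time $\tau$ at which the deficit exceeds $a$. Let $D_t$ and $I_t$ be the cumulative dividends and capital injections of this policy, and let $$J_x^{a,b}=\mathbb E_x\Big[\int_{[0,\tau)}e^{-qt}\,(dD_t-k\,dI_t)-P e^{-q\tau}\Big],\qquad x\in\mathbb R ,$$ with $e^{-q\tau}=0$ if $\tau=\infty$. Assume that $f$ is continuous at $a+b$ and that $f(a+b)>0$ or $\int_a^{a+b}f(u)\,du>0$. Then the random variable inside the expectation is integrable for every $x\in\mathbb R$, the function $a'\mapsto J_0^{a',b}$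 is differentiable at $a$, and $$\frac{\partial}{\partial a}J_0^{a,b}=0\iff J_0^{a,b}=ka-P\iff J_{-a}^{a,b}=-P .$$ -/

import Mathlib

open MeasureTheory ProbabilityTheory

/-- The noise of a Cramér–Lundberg risk process without diffusion: the inter-arrival times `w n` of
the Poisson process of intensity `lam` are exponential of rate `lam`, the claim sizes `xi n` have
density `f` on `(0, ∞)`, and all these random variables are independent. The uncontrolled risk
process is then `X_t = x + c t - ∑_{i < N_t} xi i`, where `N_t = #{n ≥ 1 : w 0 + ⋯ + w (n-1) ≤ t}`. -/
structure IsCramerLundberg {Ω : Type*} [MeasurableSpace Ω] (μ : Measure Ω) (lam : ℝ) (f : ℝ → ℝ)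
    (w xi : ℕ → Ω → ℝ) : Prop where
  lam_pos : 0 < lam
  measurable_density : Measurable f
  density_nonneg : ∀ u, 0 < u → 0 ≤ f u
  measurable_interarrival : ∀ n, Measurable (w n)
  measurable_claim : ∀ n, Measurable (xi n)
  law_interarrival : ∀ n, μ.map (w n) = expMeasure lam
  law_claim : ∀ n, μ.map (xi n) =
    (volume.restrict (Set.Ioi 0)).withDensity (fun u => ENNReal.ofReal (f u))
  indep : iIndepFun (fun i : ℕ ⊕ ℕ => Sum.elim w xi i) μ

namespace BufferPolicy

noncomputable section

/-- The time `T_n` of the `n`-th claim (`T_0 = 0` is the initial time). -/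
def claimTime (w : ℕ → ℝ) (n : ℕ) : ℝ := ∑ i ∈ Finset.range n, w i

/-- The surplus to which the control moves the level `z`: an injection brings a negative level up
to `0`, a dividend brings a level above `b` down to `b`. -/
def regulate (b z : ℝ) : ℝ := max 0 (min z b)

/-- The surplus at the time `T_n`, after the `n`-th claim and before any control is applied at that
time, under the `(-a, 0, b)` policy started from `x` (`n = 0`: the initial surplus). Between claims
the regulated surplus grows at rate `c` until it reaches `b` and then stays there, the premiums
being paid out as dividends. The value is meaningful until bankruptcy, and on that range
it does not depend on `a`. -/
def level (c b x : ℝ) (w xi : ℕ → ℝ) : ℕ → ℝ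
  | 0 => x
  | n + 1 => min (regulate b (level c b x w xi n) + c * w n) b - xi n

/-- Bankruptcy is not declared at any of the times `T_0, …, T_{n-1}`. It is declared as soon as the
deficit exceeds `a`. -/
def AliveBefore (a c b x : ℝ) (w xi : ℕ → ℝ) (n : ℕ) : Prop :=
  ∀ i, i < n → -a ≤ level c b x w xi i

/-- The first time in `[T_n, T_{n+1}]` at which the regulated surplus is at the barrier `b`
(`T_{n+1}` if the barrier is not reached before). -/
def barrierTime (c b x : ℝ) (w xi : ℕ → ℝ) (n : ℕ) : ℝ :=
  min (claimTime w (n + 1)) (claimTime w n + (b - regulate b (level c b x w xi n)) / c)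

open Classical in
/-- Dividends discounted at rate `q`, up to bankruptcy: the excess over `b` is paid at once
(this occurs only at time `0`), and dividends are paid at rate `c` while the surplus is at `b`. -/
def dividends (q a c b x : ℝ) (w xi : ℕ → ℝ) : ℝ :=
  ∑' n, if AliveBefore a c b x w xi (n + 1) then
    Real.exp (-q * claimTime w n) * max (level c b x w xi n - b) 0
      + ∫ t in (barrierTime c b x w xi n)..(claimTime w (n + 1)), c * Real.exp (-q * t)
  else 0

open Classical in
/-- Capital injections discounted at rate `q`, up to bankruptcy: every deficit of size at most `a`
is covered at once. -/
def injections (q a c b x : ℝ) (w xi : ℕ → ℝ) : ℝ :=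
  ∑' n, if AliveBefore a c b x w xi (n + 1) then
    Real.exp (-q * claimTime w n) * max (-level c b x w xi n) 0
  else 0

open Classical in
/-- `exp (-q τ)` for the bankruptcy time `τ`, the first `T_n` at which the deficit exceeds `a`;
it is `0` if bankruptcy never occurs. -/
def bankruptcyDiscount (q a c b x : ℝ) (w xi : ℕ → ℝ) : ℝ :=
  ∑' n, if AliveBefore a c b x w xi n ∧ level c b x w xi n < -a then
    Real.exp (-q * claimTime w n)
  else 0

/-- The discounted profit along a path: dividends, minus injections at proportional cost `k`,
minus the penalty `P` paid at bankruptcy. -/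
def profit (q c k P a b x : ℝ) (w xi : ℕ → ℝ) : ℝ :=
  dividends q a c b x w xi - k * injections q a c b x w xi
    - P * bankruptcyDiscount q a c b x w xi

/-- The expected discounted profit `J_x^{a,b}` of the `(-a, 0, b)` policy. -/
def J {Ω : Type*} [MeasurableSpace Ω] (μ : Measure Ω) (w xi : ℕ → Ω → ℝ) (q c k P a b x : ℝ) : ℝ :=
  ∫ ω, profit q c k P a b x (fun n => w n ω) (fun n => xi n ω) ∂μ

end

end BufferPolicy

/-!
The controlled surplus is a renewal process at the claim times. Let `Q` be the law of the level at
the first deficit, started from `0` and weighted by the discount factor up to that time, so that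
`G t = Q [-t, 0)` is the discounted probability that the first deficit is at most `t`. Until the
first deficit the policy does not depend on the threshold; at the first deficit it either covers
the deficit and restarts from `0`, or declares bankruptcy. Hence (`J_zero_eq`)
`J_0^t (1 - G t) = S - k B t - P (Q (-∞, 0) - G t)` with `B t = ∫_{[-t,0)} -z dQ` and `S` the
dividends paid before the first deficit, where `S` does not depend on `t`, and `G t < 1` thanks to
discounting (`nextLevel_occupation_Iio_lt_one`). If `G` is differentiable at `a` with derivative
`g`, then `B` has derivative `a g` (`hasDerivAt_firstMoment`), and the quotient rule gives
`(1 - G a) ∂J_0^a/∂a = g (J_0^a - (k a - P))` (`exists_hasDerivAt_J`). The theorem follows from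
`g > 0`, together with `J_{-a} = J_0 - k a` (`J_of_mem_Ico`).

The measure `Q` comes from the discounted occupation measure `R` of the levels after the claims up
to the first deficit (`occupation`). It solves the renewal equation `occupation_eq`, and integrating
the one-step equation of `x ↦ J_x` (the Markov property at the first claim,
`J_eq_firstDividends_add`) against `R` yields `J_zero_eq`; no strong Markov property is needed.

For the differentiability of `G` let `M` be the discounted law of the levels just before the claims.
The deficit has density `u ↦ ∫ f (m + u) dM(m)` (`nextLevel_real_Ico`). The measure `M` has an atom
at the barrier `b` and a bounded density below it, because the interarrival times have one. The atom
contributes a multiple of `f (b + u)`, which is continuous at `u = a` by hypothesis; the rest is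
continuous in `u` because translation is continuous in `L¹`. The density is positive at `a` because
`M` charges both `b` and every set of positive length in `(0, b)` (`deficitDensity_pos`).
-/

namespace BufferPolicy

noncomputable section

/-! ### The control along a single path -/

/-- The sequence `u` without its first entry. -/
def shift (u : ℕ → ℝ) : ℕ → ℝ := fun n => u (n + 1)

/-- Paths with nonnegative interarrival times and claims, along which the discount factors at the
claim times are summable. Almost every path is of this kind. -/
structure IsRegularPath (q : ℝ) (w xi : ℕ → ℝ) : Prop where
  interarrival_nonneg : ∀ n, 0 ≤ w n
  claim_nonneg : ∀ n, 0 ≤ xi n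
  summable_discount : Summable fun n => Real.exp (-q * claimTime w n)

open Classical in
/-- The contribution of `[T_n, T_{n+1})` to `dividends`. -/
def dividendTerm (q a c b x : ℝ) (w xi : ℕ → ℝ) (n : ℕ) : ℝ :=
  if AliveBefore a c b x w xi (n + 1) then
    Real.exp (-q * claimTime w n) * max (level c b x w xi n - b) 0
      + ∫ t in (barrierTime c b x w xi n)..(claimTime w (n + 1)), c * Real.exp (-q * t)
  else 0

open Classical in
/-- The contribution of the time `T_n` to `injections`. -/
def injectionTerm (q a c b x : ℝ) (w xi : ℕ → ℝ) (n : ℕ) : ℝ :=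
  if AliveBefore a c b x w xi (n + 1) then
    Real.exp (-q * claimTime w n) * max (-level c b x w xi n) 0
  else 0

open Classical in
/-- The contribution of the time `T_n` to `bankruptcyDiscount`. -/
def bankruptcyTerm (q a c b x : ℝ) (w xi : ℕ → ℝ) (n : ℕ) : ℝ :=
  if AliveBefore a c b x w xi n ∧ level c b x w xi n < -a then
    Real.exp (-q * claimTime w n)
  else 0

/-- The contribution of `[T_n, T_{n+1})` to `profit`. -/
def profitTerm (q c k P a b x : ℝ) (w xi : ℕ → ℝ) (n : ℕ) : ℝ :=
  dividendTerm q a c b x w xi n - k * injectionTerm q a c b x w xi n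
    - P * bankruptcyTerm q a c b x w xi n

variable {q c k P a b x : ℝ} {w xi : ℕ → ℝ}

lemma regulate_le (hb : 0 ≤ b) (z : ℝ) : regulate b z ≤ b := max_le hb (min_le_right _ _)

lemma regulate_of_mem (hx : x ∈ Set.Icc 0 b) : regulate b x = x := by
  rw [regulate, min_eq_left hx.2, max_eq_right hx.1]

lemma regulate_of_nonpos (hx : x ≤ 0) : regulate b x = 0 :=
  max_eq_left ((min_le_left _ _).trans hx)

lemma level_succ_le (hxi : ∀ n, 0 ≤ xi n) (n : ℕ) : level c b x w xi (n + 1) ≤ b := by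
  have h1 : min (regulate b (level c b x w xi n) + c * w n) b ≤ b := min_le_right _ _
  have h2 := hxi n
  simp only [level]
  linarith

lemma claimTime_succ (w : ℕ → ℝ) (n : ℕ) : claimTime w (n + 1) = claimTime w n + w n :=
  Finset.sum_range_succ _ _

lemma claimTime_zero (w : ℕ → ℝ) : claimTime w 0 = 0 := Finset.sum_range_zero _

lemma claimTime_succ_eq_add_shift (w : ℕ → ℝ) (n : ℕ) :
    claimTime w (n + 1) = w 0 + claimTime (shift w) n := by
  rw [claimTime, Finset.sum_range_succ', add_comm]; rfl

lemma claimTime_nonneg (hw : ∀ n, 0 ≤ w n) (n : ℕ) : 0 ≤ claimTime w n :=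
  Finset.sum_nonneg fun i _ => hw i

lemma level_succ_eq_shift (c b x : ℝ) (w xi : ℕ → ℝ) (n : ℕ) :
    level c b x w xi (n + 1) = level c b (level c b x w xi 1) (shift w) (shift xi) n := by
  induction n with
  | zero => rfl
  | succ n ih => rw [level, ih]; rfl

lemma aliveBefore_zero : AliveBefore a c b x w xi 0 := fun i hi => absurd hi (Nat.not_lt_zero i)

lemma aliveBefore_succ (n : ℕ) : AliveBefore a c b x w xi (n + 1) ↔
    -a ≤ x ∧ AliveBefore a c b (level c b x w xi 1) (shift w) (shift xi) n := by
  constructor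
  · intro h
    refine ⟨h 0 n.succ_pos, fun i hi => ?_⟩
    rw [← level_succ_eq_shift]
    exact h (i + 1) (by omega)
  · rintro ⟨h0, h⟩ i hi
    cases i with
    | zero => exact h0
    | succ i =>
      rw [level_succ_eq_shift]
      exact h i (by omega)

lemma barrierTime_succ (n : ℕ) : barrierTime c b x w xi (n + 1) =
    w 0 + barrierTime c b (level c b x w xi 1) (shift w) (shift xi) n := by
  rw [barrierTime, barrierTime, claimTime_succ_eq_add_shift, claimTime_succ_eq_add_shift w n,
    level_succ_eq_shift, add_assoc, min_add_add_left]

lemma barrierTime_le : barrierTime c b x w xi n ≤ claimTime w (n + 1) := min_le_left _ _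

lemma claimTime_le_barrierTime (hc : 0 < c) (hb : 0 ≤ b) (hw : ∀ n, 0 ≤ w n) (n : ℕ) :
    claimTime w n ≤ barrierTime c b x w xi n := by
  refine le_min ?_ ?_
  · rw [claimTime_succ]; linarith [hw n]
  · have := div_nonneg (sub_nonneg.2 (regulate_le hb (level c b x w xi n))) hc.le
    linarith

lemma integral_discount (hq : 0 < q) (c u v : ℝ) :
    ∫ t in u..v, c * Real.exp (-q * t) = c / q * (Real.exp (-q * u) - Real.exp (-q * v)) := by
  have h : ∀ t ∈ Set.uIcc u v,
      HasDerivAt (fun t => -(c / q) * Real.exp (-q * t)) (c * Real.exp (-q * t)) t := by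
    intro t _
    have h1 : HasDerivAt (fun t : ℝ => -q * t) (-q) t := by
      simpa using (hasDerivAt_id t).const_mul (-q)
    convert! (h1.exp).const_mul (-(c / q)) using 1
    field_simp
  rw [intervalIntegral.integral_eq_sub_of_hasDerivAt h
    (by apply Continuous.intervalIntegrable; fun_prop)]
  ring

open Classical in
lemma dividendTerm_succ (hq : 0 < q) (hx : -a ≤ x) (n : ℕ) : dividendTerm q a c b x w xi (n + 1) =
    Real.exp (-q * w 0) *
      dividendTerm q a c b (level c b x w xi 1) (shift w) (shift xi) n := by
  have hA := (aliveBefore_succ (a := a) (c := c) (b := b) (x := x) (w := w) (xi := xi)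
    (n + 1)).trans (and_iff_right hx)
  rw [dividendTerm, dividendTerm, if_congr hA rfl rfl, mul_ite, mul_zero, integral_discount hq,
    integral_discount hq, barrierTime_succ, claimTime_succ_eq_add_shift w n,
    claimTime_succ_eq_add_shift w (n + 1), level_succ_eq_shift c b x w xi n]
  simp only [mul_add, Real.exp_add]
  congr 1
  ring

open Classical in
lemma injectionTerm_succ (hx : -a ≤ x) (n : ℕ) : injectionTerm q a c b x w xi (n + 1) =
    Real.exp (-q * w 0) *
      injectionTerm q a c b (level c b x w xi 1) (shift w) (shift xi) n := by
  have hA := (aliveBefore_succ (a := a) (c := c) (b := b) (x := x) (w := w) (xi := xi)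
    (n + 1)).trans (and_iff_right hx)
  rw [injectionTerm, injectionTerm, if_congr hA rfl rfl, mul_ite, mul_zero,
    claimTime_succ_eq_add_shift w n, level_succ_eq_shift c b x w xi n, mul_add, Real.exp_add,
    mul_assoc]

open Classical in
lemma bankruptcyTerm_succ (hx : -a ≤ x) (n : ℕ) : bankruptcyTerm q a c b x w xi (n + 1) =
    Real.exp (-q * w 0) *
      bankruptcyTerm q a c b (level c b x w xi 1) (shift w) (shift xi) n := by
  have hA := (aliveBefore_succ (a := a) (c := c) (b := b) (x := x) (w := w) (xi := xi)
    n).trans (and_iff_right hx)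
  rw [bankruptcyTerm, bankruptcyTerm, level_succ_eq_shift c b x w xi n,
    if_congr (and_congr_left' hA) rfl rfl, mul_ite, mul_zero, claimTime_succ_eq_add_shift w n,
    mul_add, Real.exp_add]

lemma profitTerm_succ (hq : 0 < q) (hx : -a ≤ x) (n : ℕ) :
    profitTerm q c k P a b x w xi (n + 1) = Real.exp (-q * w 0) *
      profitTerm q c k P a b (level c b x w xi 1) (shift w) (shift xi) n := by
  rw [profitTerm, profitTerm, dividendTerm_succ hq hx, injectionTerm_succ hx,
    bankruptcyTerm_succ hx]
  ring

/-! ### Bounds, and the recursion at the first claim -/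

lemma dividendTerm_nonneg (hq : 0 < q) (hc : 0 < c) (n : ℕ) :
    0 ≤ dividendTerm q a c b x w xi n := by
  rw [dividendTerm]
  split_ifs
  · rw [integral_discount hq]
    have h1 : Real.exp (-q * claimTime w (n + 1)) ≤ Real.exp (-q * barrierTime c b x w xi n) := by
      apply Real.exp_le_exp.2
      nlinarith [barrierTime_le (c := c) (b := b) (x := x) (w := w) (xi := xi) (n := n)]
    have := mul_nonneg (div_nonneg hc.le hq.le) (sub_nonneg.2 h1)
    positivity
  · rfl

lemma dividendTerm_le (hq : 0 < q) (hc : 0 < c) (hb : 0 ≤ b) (h : IsRegularPath q w xi) (n : ℕ) :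
    dividendTerm q a c b x w xi n ≤
      (max (x - b) 0 + c / q) * Real.exp (-q * claimTime w n) := by
  have hcq : 0 ≤ c / q := div_nonneg hc.le hq.le
  rw [dividendTerm]
  split_ifs
  · rw [integral_discount hq]
    have h1 : Real.exp (-q * barrierTime c b x w xi n) ≤ Real.exp (-q * claimTime w n) := by
      apply Real.exp_le_exp.2
      nlinarith [claimTime_le_barrierTime (x := x) (xi := xi) hc hb h.interarrival_nonneg n]
    have h2 : c / q * (Real.exp (-q * barrierTime c b x w xi n) -
        Real.exp (-q * claimTime w (n + 1))) ≤ c / q * Real.exp (-q * claimTime w n) := by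
      apply mul_le_mul_of_nonneg_left _ hcq
      linarith [Real.exp_pos (-q * claimTime w (n + 1))]
    have h3 : max (level c b x w xi n - b) 0 ≤ max (x - b) 0 := by
      cases n with
      | zero => exact le_rfl
      | succ n =>
        rw [max_eq_right (sub_nonpos.2 (level_succ_le h.claim_nonneg n))]
        exact le_max_right _ _
    nlinarith [Real.exp_pos (-q * claimTime w n)]
  · positivity

lemma injectionTerm_nonneg (n : ℕ) : 0 ≤ injectionTerm q a c b x w xi n := by
  rw [injectionTerm]; split_ifs <;> positivity

lemma injectionTerm_le (ha : 0 < a) (n : ℕ) :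
    injectionTerm q a c b x w xi n ≤ a * Real.exp (-q * claimTime w n) := by
  rw [injectionTerm]
  split_ifs with h
  · have : max (-level c b x w xi n) 0 ≤ a := max_le (by linarith [h n n.lt_succ_self]) ha.le
    nlinarith [Real.exp_pos (-q * claimTime w n)]
  · positivity

lemma bankruptcyTerm_nonneg (n : ℕ) : 0 ≤ bankruptcyTerm q a c b x w xi n := by
  rw [bankruptcyTerm]; split_ifs <;> positivity

lemma bankruptcyTerm_le (n : ℕ) :
    bankruptcyTerm q a c b x w xi n ≤ Real.exp (-q * claimTime w n) := by
  rw [bankruptcyTerm]; split_ifs <;> [exact le_rfl; positivity]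

/-- A factor `C` such that the profit from the initial surplus `x` is at most
`C * ∑ n, exp (-q T_n)` in absolute value. -/
def profitBound (q c k P a b x : ℝ) : ℝ := max (x - b) 0 + c / q + |k| * a + |P|

lemma abs_profitTerm_le (hq : 0 < q) (hc : 0 < c) (hb : 0 ≤ b) (ha : 0 < a)
    (h : IsRegularPath q w xi) (n : ℕ) : |profitTerm q c k P a b x w xi n| ≤
      profitBound q c k P a b x * Real.exp (-q * claimTime w n) := by
  have h1 := abs_of_nonneg (dividendTerm_nonneg (a := a) (b := b) (x := x) (w := w) (xi := xi)
    hq hc n)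
  have h2 := abs_of_nonneg (injectionTerm_nonneg (q := q) (a := a) (c := c) (b := b) (x := x)
    (w := w) (xi := xi) n)
  have h3 := abs_of_nonneg (bankruptcyTerm_nonneg (q := q) (a := a) (c := c) (b := b) (x := x)
    (w := w) (xi := xi) n)
  have h4 := dividendTerm_le (a := a) (x := x) hq hc hb h n
  have h5 := mul_le_mul_of_nonneg_left (injectionTerm_le (q := q) (c := c) (b := b) (x := x)
    (w := w) (xi := xi) ha n) (abs_nonneg k)
  have h6 := mul_le_mul_of_nonneg_left (bankruptcyTerm_le (q := q) (a := a) (c := c) (b := b)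
    (x := x) (w := w) (xi := xi) n) (abs_nonneg P)
  rw [profitTerm]
  refine (abs_sub _ _).trans ((add_le_add_left (abs_sub _ _) _).trans ?_)
  rw [abs_mul, abs_mul, h1, h2, h3, profitBound]
  linarith

lemma summable_profitTerm (hq : 0 < q) (hc : 0 < c) (hb : 0 ≤ b) (ha : 0 < a)
    (h : IsRegularPath q w xi) : Summable (profitTerm q c k P a b x w xi) :=
  .of_norm_bounded (h.summable_discount.mul_left _) (abs_profitTerm_le hq hc hb ha h)

lemma profit_eq_tsum (hq : 0 < q) (hc : 0 < c) (hb : 0 ≤ b) (ha : 0 < a)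
    (h : IsRegularPath q w xi) :
    profit q c k P a b x w xi = ∑' n, profitTerm q c k P a b x w xi n := by
  have s1 : Summable (dividendTerm q a c b x w xi) :=
    .of_nonneg_of_le (dividendTerm_nonneg hq hc) (dividendTerm_le hq hc hb h)
      (h.summable_discount.mul_left _)
  have s2 : Summable (injectionTerm q a c b x w xi) :=
    .of_nonneg_of_le injectionTerm_nonneg (injectionTerm_le ha) (h.summable_discount.mul_left _)
  have s3 : Summable (bankruptcyTerm q a c b x w xi) :=
    .of_nonneg_of_le bankruptcyTerm_nonneg bankruptcyTerm_le h.summable_discount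
  simp only [profitTerm]
  rw [(s1.sub (s2.mul_left k)).tsum_sub (s3.mul_left P), s1.tsum_sub (s2.mul_left k),
    tsum_mul_left, tsum_mul_left]
  rfl

lemma abs_profit_le (hq : 0 < q) (hc : 0 < c) (hb : 0 ≤ b) (ha : 0 < a)
    (h : IsRegularPath q w xi) : |profit q c k P a b x w xi| ≤
      profitBound q c k P a b x * ∑' n, Real.exp (-q * claimTime w n) := by
  rw [profit_eq_tsum hq hc hb ha h]
  exact tsum_of_norm_bounded (f := profitTerm q c k P a b x w xi)
    (h.summable_discount.hasSum.mul_left _) (abs_profitTerm_le hq hc hb ha h)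

lemma IsRegularPath.shift (h : IsRegularPath q w xi) :
    IsRegularPath q (shift w) (shift xi) where
  interarrival_nonneg n := h.interarrival_nonneg _
  claim_nonneg n := h.claim_nonneg _
  summable_discount := by
    have h1 := (summable_nat_add_iff 1).2 h.summable_discount
    simp only [claimTime_succ_eq_add_shift w, mul_add, Real.exp_add] at h1
    exact (summable_mul_left_iff (Real.exp_pos _).ne').1 h1

/-- The value of the controlled path splits at the first claim. -/
lemma profit_eq_add_shift (hq : 0 < q) (hc : 0 < c) (hb : 0 ≤ b) (ha : 0 < a)
    (h : IsRegularPath q w xi) (hx : -a ≤ x) :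
    profit q c k P a b x w xi = profitTerm q c k P a b x w xi 0 + Real.exp (-q * w 0) *
      profit q c k P a b (level c b x w xi 1) (shift w) (shift xi) := by
  rw [profit_eq_tsum hq hc hb ha h, (summable_profitTerm hq hc hb ha h).tsum_eq_zero_add,
    profit_eq_tsum hq hc hb ha h.shift, ← tsum_mul_left]
  simp only [profitTerm_succ hq hx]

/-- Bankruptcy is declared at once if the initial deficit exceeds `a`. -/
lemma profit_of_lt (hx : x < -a) : profit q c k P a b x w xi = -P := by
  have h1 : ∀ n, ¬ AliveBefore a c b x w xi (n + 1) := fun n h =>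
    not_le.2 hx ((aliveBefore_succ n).1 h).1
  have h2 : bankruptcyDiscount q a c b x w xi = 1 := by
    rw [bankruptcyDiscount, tsum_eq_single 0]
    · simp [aliveBefore_zero, level, hx, claimTime_zero]
    · intro n hn
      obtain ⟨m, rfl⟩ := Nat.exists_eq_succ_of_ne_zero hn
      simp [h1 m]
  simp [profit, h2, dividends, injections, h1]

lemma aliveBefore_one : AliveBefore a c b x w xi 1 ↔ -a ≤ x := by
  rw [aliveBefore_succ]; exact and_iff_left aliveBefore_zero

/-- For an initial surplus in `[0, b]`, only the dividends paid until the first claim contribute to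
the initial term, which therefore does not depend on `a`. -/
lemma profitTerm_zero_of_mem (ha : 0 < a) (hx : x ∈ Set.Icc 0 b) :
    profitTerm q c k P a b x w xi 0 =
      ∫ t in (barrierTime c b x w xi 0)..(claimTime w 1), c * Real.exp (-q * t) := by
  have h0 : -a ≤ x := by linarith [hx.1]
  simp [profitTerm, dividendTerm, injectionTerm, bankruptcyTerm, aliveBefore_one, level, h0, hx.1,
    hx.2, not_lt.2 h0]

/-- A covered initial deficit costs `k` times its size, after which the path continues from `0`. -/
lemma profit_of_mem_Ico (hq : 0 < q) (hc : 0 < c) (hb : 0 ≤ b) (ha : 0 < a)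
    (h : IsRegularPath q w xi) (hx : x ∈ Set.Ico (-a) 0) :
    profit q c k P a b x w xi = k * x + profit q c k P a b 0 w xi := by
  have hl : level c b x w xi 1 = level c b 0 w xi 1 := by
    simp [level, regulate_of_nonpos hx.2.le, regulate_of_nonpos le_rfl]
  have ht : profitTerm q c k P a b x w xi 0 = k * x + profitTerm q c k P a b 0 w xi 0 := by
    rw [profitTerm_zero_of_mem ha ⟨le_rfl, hb⟩]
    simp only [profitTerm, dividendTerm, injectionTerm, bankruptcyTerm, zero_add, aliveBefore_one,
      hx.1, if_true, barrierTime, level, regulate_of_nonpos hx.2.le, regulate_of_nonpos le_rfl,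
      not_lt.2 hx.1, claimTime_zero]
    -- The injection `-x` is the only new contribution: the regulated level is `0` in both cases.
    rw [max_eq_right (by linarith [hx.2] : x - b ≤ 0), max_eq_left (by linarith [hx.2] : 0 ≤ -x)]
    simp [not_lt.2 hx.1]
    ring
  rw [profit_eq_add_shift hq hc hb ha h hx.1, profit_eq_add_shift hq hc hb ha h
    (by linarith : -a ≤ 0), hl, ht]
  ring

/-! ### Measurability in the initial surplus and the path -/

lemma measurable_level (c b : ℝ) (n : ℕ) :
    Measurable fun p : ℝ × (ℕ → ℝ) × (ℕ → ℝ) => level c b p.1 p.2.1 p.2.2 n := by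
  induction n with
  | zero => exact measurable_fst
  | succ n ih => simp only [level, regulate]; fun_prop

lemma measurable_claimTime (n : ℕ) : Measurable fun w : ℕ → ℝ => claimTime w n := by
  unfold claimTime; fun_prop

lemma measurableSet_aliveBefore (a c b : ℝ) (n : ℕ) :
    MeasurableSet {p : ℝ × (ℕ → ℝ) × (ℕ → ℝ) | AliveBefore a c b p.1 p.2.1 p.2.2 n} := by
  simp only [AliveBefore, Set.ofPred_forall]
  exact .iInter fun i => .iInter fun _ => measurableSet_le measurable_const (measurable_level c b i)

lemma measurable_profit (hq : 0 < q) (c k P a b : ℝ) :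
    Measurable fun p : ℝ × (ℕ → ℝ) × (ℕ → ℝ) => profit q c k P a b p.1 p.2.1 p.2.2 := by
  have hl := measurable_level c b
  have hA := measurableSet_aliveBefore a c b
  have hT : ∀ n, Measurable fun p : ℝ × (ℕ → ℝ) × (ℕ → ℝ) => claimTime p.2.1 n := fun n =>
    (measurable_claimTime n).comp (by fun_prop)
  unfold profit dividends injections bankruptcyDiscount
  simp only [integral_discount hq]
  refine (Measurable.sub (Measurable.tsum fun n => ?_)
    (measurable_const.mul (Measurable.tsum fun n => ?_))).sub
    (measurable_const.mul (Measurable.tsum fun n => ?_))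
  · refine Measurable.ite (hA (n + 1)) ?_ measurable_const
    have := hl n
    have := hT n
    have := hT (n + 1)
    simp only [barrierTime, regulate]
    fun_prop
  · refine Measurable.ite (hA (n + 1)) ?_ measurable_const
    have := hl n
    have := hT n
    fun_prop
  · refine Measurable.ite ((hA n).inter (measurableSet_lt (hl n) measurable_const)) ?_
      measurable_const
    have := hT n
    fun_prop

end

/-! ### The law of the noise -/

section Law

variable {Ω : Type*}

/-- The σ-algebra on `Ω` is arbitrary, so that the lemma also applies to the σ-algebra generated by
part of the noise. -/
lemma measurable_noise [MeasurableSpace Ω] {w xi : ℕ → Ω → ℝ} (hw : ∀ n, Measurable (w n))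
    (hxi : ∀ n, Measurable (xi n)) :
    Measurable fun ω => ((fun n => w n ω, fun n => xi n ω) : (ℕ → ℝ) × (ℕ → ℝ)) :=
  (measurable_pi_lambda _ hw).prodMk (measurable_pi_lambda _ hxi)

variable [MeasurableSpace Ω] {μ : Measure Ω}
  {lam : ℝ} {f : ℝ → ℝ} {w xi : ℕ → Ω → ℝ} {q c k P a b x : ℝ}

/-- The law of a single claim of density `f` on `(0, ∞)`. -/
noncomputable def claimLaw (f : ℝ → ℝ) : Measure ℝ :=
  (volume.restrict (Set.Ioi 0)).withDensity fun u => ENNReal.ofReal (f u)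

/-- The law of the whole noise, as a pair of sequences. -/
noncomputable def noiseLaw (μ : Measure Ω) (w xi : ℕ → Ω → ℝ) :
    Measure ((ℕ → ℝ) × (ℕ → ℝ)) :=
  μ.map fun ω => (fun n => w n ω, fun n => xi n ω)

/-- The noise after the first claim has the same law as the whole noise. -/
lemma noiseLaw_shift (hCL : IsCramerLundberg μ lam f w xi) :
    noiseLaw μ (fun n => w (n + 1)) (fun n => xi (n + 1)) = noiseLaw μ w xi := by
  have hm : ∀ i : ℕ ⊕ ℕ, Measurable fun ω => Sum.elim w xi i ω := by
    rintro (n | n)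
    exacts [hCL.measurable_interarrival n, hCL.measurable_claim n]
  let g : ℕ ⊕ ℕ → ℕ ⊕ ℕ := Sum.map Nat.succ Nat.succ
  have hg : Function.Injective g := Sum.map_injective.2 ⟨Nat.succ_injective, Nat.succ_injective⟩
  have h1 := (hCL.indep.precomp hg).map_fun_eq_infinitePi_map (fun i => hm (g i))
  have h2 := hCL.indep.map_fun_eq_infinitePi_map hm
  have h3 : (fun i : ℕ ⊕ ℕ => μ.map (fun ω => Sum.elim w xi (g i) ω)) =
      fun i : ℕ ⊕ ℕ => μ.map (fun ω => Sum.elim w xi i ω) := by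
    funext i
    rcases i with n | n
    · exact (hCL.law_interarrival _).trans (hCL.law_interarrival _).symm
    · exact (hCL.law_claim _).trans (hCL.law_claim _).symm
  have h4 : μ.map (fun ω i => Sum.elim w xi (g i) ω) = μ.map (fun ω i => Sum.elim w xi i ω) :=
    h1.trans ((congrArg _ h3).trans h2.symm)
  have hsplit : Measurable fun s : ℕ ⊕ ℕ → ℝ =>
      ((fun n => s (Sum.inl n), fun n => s (Sum.inr n)) : (ℕ → ℝ) × (ℕ → ℝ)) := by fun_prop
  have h5 := congrArg (Measure.map fun s : ℕ ⊕ ℕ → ℝ =>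
      ((fun n => s (Sum.inl n), fun n => s (Sum.inr n)) : (ℕ → ℝ) × (ℕ → ℝ))) h4
  rwa [Measure.map_map hsplit (measurable_pi_lambda _ fun i => hm (g i)),
    Measure.map_map hsplit (measurable_pi_lambda _ hm)] at h5

/-- The first interarrival time and the first claim are independent of the noise that follows. -/
lemma indepFun_first_shift (hCL : IsCramerLundberg μ lam f w xi) :
    IndepFun (fun ω => (w 0 ω, xi 0 ω))
      (fun ω => ((fun n => w (n + 1) ω, fun n => xi (n + 1) ω) : (ℕ → ℝ) × (ℕ → ℝ))) μ := by
  have hm : ∀ i : ℕ ⊕ ℕ, Measurable fun ω => Sum.elim w xi i ω := by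
    rintro (n | n)
    exacts [hCL.measurable_interarrival n, hCL.measurable_claim n]
  let S : Set (ℕ ⊕ ℕ) := {Sum.inl 0, Sum.inr 0}
  have h := indep_iSup_of_disjoint (S := S) (T := Sᶜ) (fun i => (hm i).comap_le)
    hCL.indep.iIndep disjoint_compl_right
  have key : ∀ (T : Set (ℕ ⊕ ℕ)) (i : ℕ ⊕ ℕ), i ∈ T →
      Measurable[⨆ j ∈ T, MeasurableSpace.comap (fun ω => Sum.elim w xi j ω) inferInstance]
        fun ω => Sum.elim w xi i ω := fun T i hi =>
    (comap_measurable _).mono (le_iSup₂_of_le i hi le_rfl) le_rfl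
  refine indep_of_indep_of_le_left (indep_of_indep_of_le_right h ?_) ?_
  · refine Measurable.comap_le ?_
    exact @measurable_noise Ω (⨆ j ∈ Sᶜ, MeasurableSpace.comap (fun ω => Sum.elim w xi j ω)
      inferInstance) _ _ (fun n => key Sᶜ (Sum.inl (n + 1)) (by simp [S]))
      (fun n => key Sᶜ (Sum.inr (n + 1)) (by simp [S]))
  · refine Measurable.comap_le ?_
    exact @Measurable.prodMk Ω (⨆ j ∈ S, MeasurableSpace.comap
      (fun ω => Sum.elim w xi j ω) inferInstance) ℝ ℝ _ _ _ _ (key S (Sum.inl 0) (by simp [S]))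
      (key S (Sum.inr 0) (by simp [S]))

lemma map_first [IsProbabilityMeasure μ] (hCL : IsCramerLundberg μ lam f w xi) :
    μ.map (fun ω => (w 0 ω, xi 0 ω)) = (expMeasure lam).prod (claimLaw f) := by
  have h := hCL.indep.indepFun (i := Sum.inl 0) (j := Sum.inr 0) (by simp)
  have := (indepFun_iff_map_prod_eq_prod_map_map
    (hCL.measurable_interarrival 0).aemeasurable (hCL.measurable_claim 0).aemeasurable).1 h
  rw [hCL.law_interarrival, hCL.law_claim] at this
  exact this

/-- Joint law of the first interarrival time, the first claim and the noise that follows. -/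
lemma map_first_shift [IsProbabilityMeasure μ] (hCL : IsCramerLundberg μ lam f w xi) :
    μ.map (fun ω => ((w 0 ω, xi 0 ω),
      ((fun n => w (n + 1) ω, fun n => xi (n + 1) ω) : (ℕ → ℝ) × (ℕ → ℝ)))) =
      ((expMeasure lam).prod (claimLaw f)).prod (noiseLaw μ w xi) := by
  rw [(indepFun_iff_map_prod_eq_prod_map_map
    ((hCL.measurable_interarrival 0).prodMk (hCL.measurable_claim 0)).aemeasurable
    (measurable_noise (fun n => hCL.measurable_interarrival (n + 1))
      (fun n => hCL.measurable_claim (n + 1))).aemeasurable).1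
    (indepFun_first_shift hCL), map_first hCL]
  congr 1
  exact noiseLaw_shift hCL

/-! ### The exponential law and its discounted version -/

lemma expMeasure_eq (lam : ℝ) : expMeasure lam = (volume.restrict (Set.Ioi 0)).withDensity
    fun s => ENNReal.ofReal (lam * Real.exp (-(lam * s))) := by
  rw [← withDensity_indicator measurableSet_Ioi]
  refine withDensity_congr_ae ?_
  filter_upwards [Measure.ae_ne volume (0 : ℝ)] with s hs
  change exponentialPDF lam s = _
  rcases lt_or_gt_of_ne hs with h | h
  · rw [exponentialPDF_of_neg h, Set.indicator_of_notMem (by simpa using h.le)]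
  · rw [exponentialPDF_of_nonneg h.le, Set.indicator_of_mem (by simpa using h)]

/-- The law of an interarrival time, weighted by the discount factor over that time. -/
noncomputable def discountedExp (lam q : ℝ) : Measure ℝ :=
  (expMeasure lam).withDensity fun s => ENNReal.ofReal (Real.exp (-q * s))

lemma ae_pos_expMeasure (lam : ℝ) : ∀ᵐ s ∂(expMeasure lam), 0 < s := by
  rw [expMeasure_eq]
  exact (withDensity_absolutelyContinuous _ _).ae_le (ae_restrict_mem measurableSet_Ioi)

lemma ae_pos_claimLaw (f : ℝ → ℝ) : ∀ᵐ y ∂(claimLaw f), 0 < y :=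
  (withDensity_absolutelyContinuous _ _).ae_le (ae_restrict_mem measurableSet_Ioi)

/-- The discounted interarrival time has a density bounded by `lam`. -/
lemma discountedExp_le (hlam : 0 < lam) (hq : 0 < q) :
    discountedExp lam q ≤ ENNReal.ofReal lam • volume := by
  have h1 : discountedExp lam q ≤ expMeasure lam := by
    rw [discountedExp]
    refine (withDensity_mono (g := 1) ?_).trans_eq withDensity_one
    filter_upwards [ae_pos_expMeasure lam] with s hs
    exact ENNReal.ofReal_le_one.2 (Real.exp_le_one_iff.2 (by nlinarith))
  refine h1.trans ?_
  rw [expMeasure_eq]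
  refine (withDensity_mono (g := fun _ => ENNReal.ofReal lam) ?_).trans ?_
  · filter_upwards [ae_restrict_mem measurableSet_Ioi] with s hs
    have hs' : (0 : ℝ) < s := hs
    have : Real.exp (-(lam * s)) ≤ 1 := Real.exp_le_one_iff.2 (by nlinarith)
    exact ENNReal.ofReal_le_ofReal (by nlinarith)
  · rw [withDensity_const]
    exact Measure.le_intro fun A _ _ => mul_le_mul_right (Measure.restrict_apply_le _ _) _

lemma absolutelyContinuous_discountedExp (hlam : 0 < lam) (q : ℝ) :
    volume.restrict (Set.Ioi 0) ≪ discountedExp lam q := by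
  have h1 : volume.restrict (Set.Ioi 0) ≪ expMeasure lam := by
    rw [expMeasure_eq]
    exact withDensity_absolutelyContinuous' (by fun_prop)
      (.of_forall fun s => (ENNReal.ofReal_pos.2 (by positivity)).ne')
  exact h1.trans (withDensity_absolutelyContinuous' (by fun_prop)
    (.of_forall fun s => (ENNReal.ofReal_pos.2 (Real.exp_pos _)).ne'))

/-- Discounting over an interarrival time loses mass; this makes all series below converge. -/
lemma discountedExp_univ_lt_one (hlam : 0 < lam) (hq : 0 < q) :
    discountedExp lam q Set.univ < 1 := by
  have := isProbabilityMeasure_expMeasure hlam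
  rw [discountedExp, withDensity_apply _ .univ, Measure.restrict_univ]
  have hlt : ∀ᵐ s ∂(expMeasure lam), ENNReal.ofReal (Real.exp (-q * s)) < 1 := by
    filter_upwards [ae_pos_expMeasure lam] with s hs
    exact ENNReal.ofReal_lt_one.2 (by rw [← Real.exp_zero]; exact Real.exp_lt_exp.2 (by nlinarith))
  have hle : ∫⁻ s, ENNReal.ofReal (Real.exp (-q * s)) ∂(expMeasure lam) ≤ 1 :=
    (lintegral_mono_ae (hlt.mono fun s hs => hs.le)).trans (by simp)
  refine (lintegral_strict_mono (g := 1) (IsProbabilityMeasure.ne_zero _) aemeasurable_const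
    (ne_top_of_le_ne_top ENNReal.one_ne_top hle) hlt).trans_eq (by simp)

lemma isFiniteMeasure_discountedExp (hlam : 0 < lam) (hq : 0 < q) :
    IsFiniteMeasure (discountedExp lam q) :=
  ⟨(discountedExp_univ_lt_one hlam hq).trans ENNReal.one_lt_top⟩

lemma isProbabilityMeasure_claimLaw [IsProbabilityMeasure μ] (hCL : IsCramerLundberg μ lam f w xi) :
    IsProbabilityMeasure (claimLaw f) := by
  have h : claimLaw f = μ.map (xi 0) := (hCL.law_claim 0).symm
  rw [h]
  exact Measure.isProbabilityMeasure_map (hCL.measurable_claim 0).aemeasurable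

/-! ### Integrability of the profit -/

lemma integrable_discount [IsProbabilityMeasure μ] (hCL : IsCramerLundberg μ lam f w xi)
    (hq : 0 < q) (n : ℕ) :
    Integrable (fun ω => Real.exp (-q * claimTime (fun n => w n ω) n)) μ := by
  have hw : ∀ᵐ ω ∂μ, ∀ n, 0 < w n ω := ae_all_iff.2 fun n =>
    ae_of_ae_map (hCL.measurable_interarrival n).aemeasurable
      (by rw [hCL.law_interarrival]; exact ae_pos_expMeasure lam)
  have hT : Measurable fun ω => claimTime (fun n => w n ω) n :=
    (measurable_claimTime n).comp (measurable_pi_lambda _ hCL.measurable_interarrival)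
  refine Integrable.of_bound (Measurable.aestronglyMeasurable (by fun_prop)) 1 ?_
  filter_upwards [hw] with ω h
  rw [Real.norm_eq_abs, Real.abs_exp, Real.exp_le_one_iff]
  nlinarith [claimTime_nonneg (fun n => (h n).le) n]

lemma integral_discount_claimTime [IsProbabilityMeasure μ] (hCL : IsCramerLundberg μ lam f w xi)
    (n : ℕ) : ∫ ω, Real.exp (-q * claimTime (fun n => w n ω) n) ∂μ =
      (∫ s, Real.exp (-q * s) ∂(expMeasure lam)) ^ n := by
  have hind : iIndepFun w μ := hCL.indep.precomp (g := Sum.inl) Sum.inl_injective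
  have h := hind.mgf_sum (t := -q) hCL.measurable_interarrival (Finset.range n)
  have h2 : ∀ i, mgf (w i) μ (-q) = ∫ s, Real.exp (-q * s) ∂(expMeasure lam) := by
    intro i
    rw [← hCL.law_interarrival i, integral_map (hCL.measurable_interarrival i).aemeasurable
      (by fun_prop)]
    rfl
  simp only [h2, Finset.prod_const, Finset.card_range] at h
  rw [← h]
  simp [mgf, claimTime, Finset.sum_apply]

lemma integral_exp_lt_one (hlam : 0 < lam) (hq : 0 < q) :
    ∫ s, Real.exp (-q * s) ∂(expMeasure lam) < 1 := by
  have h := discountedExp_univ_lt_one hlam hq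
  rw [discountedExp, withDensity_apply _ .univ, Measure.restrict_univ] at h
  rw [integral_eq_lintegral_of_nonneg_ae (.of_forall fun s => (Real.exp_pos _).le) (by fun_prop)]
  exact ENNReal.toReal_lt_of_lt_ofReal (by simpa using h)

lemma summable_integral_discount [IsProbabilityMeasure μ]
    (hCL : IsCramerLundberg μ lam f w xi) (hq : 0 < q) :
    Summable fun n => ∫ ω, ‖Real.exp (-q * claimTime (fun n => w n ω) n)‖ ∂μ := by
  simp only [Real.norm_eq_abs, Real.abs_exp, integral_discount_claimTime hCL]
  exact summable_geometric_of_lt_one (integral_nonneg fun s => (Real.exp_pos _).le)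
    (integral_exp_lt_one hCL.lam_pos hq)

/-- The expectation of `∑ n, exp (-q T_n)` is a geometric series. -/
lemma integrable_tsum_discount [IsProbabilityMeasure μ] (hCL : IsCramerLundberg μ lam f w xi)
    (hq : 0 < q) :
    Integrable (fun ω => ∑' n, Real.exp (-q * claimTime (fun n => w n ω) n)) μ ∧
      ∀ᵐ ω ∂μ, Summable fun n => Real.exp (-q * claimTime (fun n => w n ω) n) := by
  have hT : ∀ n, Measurable fun ω => claimTime (fun n => w n ω) n := fun n =>
    (measurable_claimTime n).comp (measurable_pi_lambda _ hCL.measurable_interarrival)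
  have hm : ∀ n, Measurable fun ω =>
      ENNReal.ofReal (Real.exp (-q * claimTime (fun n => w n ω) n)) := fun n => by
    have := hT n
    fun_prop
  have hsum : ∑' n, ∫⁻ ω, ENNReal.ofReal (Real.exp (-q * claimTime (fun n => w n ω) n)) ∂μ ≠ ⊤ := by
    simp only [← ofReal_integral_eq_lintegral_ofReal (integrable_discount hCL hq _)
      (.of_forall fun ω => (Real.exp_pos _).le)]
    have h := summable_integral_discount hCL hq
    simp only [Real.norm_eq_abs, Real.abs_exp] at h
    rw [← ENNReal.ofReal_tsum_of_nonneg
      (fun n => integral_nonneg fun ω => (Real.exp_pos _).le) h]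
    exact ENNReal.ofReal_ne_top
  rw [← lintegral_tsum fun n => (hm n).aemeasurable] at hsum
  constructor
  · refine (integrable_toReal_of_lintegral_ne_top (Measurable.tsum hm).aemeasurable hsum).congr
      (.of_forall fun ω => ?_)
    simp [ENNReal.tsum_toReal_eq, Real.exp_nonneg]
  · filter_upwards [ae_lt_top (Measurable.tsum hm) hsum] with ω h
    simpa [Real.exp_nonneg] using ENNReal.summable_toReal h.ne

lemma ae_isRegularPath [IsProbabilityMeasure μ] (hCL : IsCramerLundberg μ lam f w xi)
    (hq : 0 < q) : ∀ᵐ ω ∂μ, IsRegularPath q (fun n => w n ω) (fun n => xi n ω) := by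
  have hw : ∀ᵐ ω ∂μ, ∀ n, 0 < w n ω := ae_all_iff.2 fun n =>
    ae_of_ae_map (hCL.measurable_interarrival n).aemeasurable
      (by rw [hCL.law_interarrival]; exact ae_pos_expMeasure lam)
  have hxi : ∀ᵐ ω ∂μ, ∀ n, 0 < xi n ω := ae_all_iff.2 fun n =>
    ae_of_ae_map (hCL.measurable_claim n).aemeasurable
      (by rw [hCL.law_claim]; exact ae_pos_claimLaw f)
  filter_upwards [hw, hxi, (integrable_tsum_discount hCL hq).2] with ω h1 h2 h3
  exact ⟨fun n => (h1 n).le, fun n => (h2 n).le, h3⟩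

lemma measurable_profit_noise (hCL : IsCramerLundberg μ lam f w xi) (hq : 0 < q)
    (c k P a b x : ℝ) : Measurable fun ω =>
      profit q c k P a b x (fun n => w n ω) (fun n => xi n ω) :=
  (measurable_profit hq c k P a b).comp (measurable_const.prodMk
    (measurable_noise hCL.measurable_interarrival hCL.measurable_claim))

lemma integrable_profit [IsProbabilityMeasure μ] (hCL : IsCramerLundberg μ lam f w xi)
    (hq : 0 < q) (hc : 0 < c) (hb : 0 ≤ b) (ha : 0 < a) (x : ℝ) : Integrable
      (fun ω => profit q c k P a b x (fun n => w n ω) (fun n => xi n ω)) μ := by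
  refine Integrable.mono' ((integrable_tsum_discount hCL hq).1.const_mul
    (profitBound q c k P a b x))
    (measurable_profit_noise hCL hq c k P a b x).aestronglyMeasurable ?_
  filter_upwards [ae_isRegularPath hCL hq] with ω h
  exact abs_profit_le hq hc hb ha h

lemma J_eq_integral_noiseLaw (hCL : IsCramerLundberg μ lam f w xi) (hq : 0 < q)
    (c k P a b x : ℝ) : J μ w xi q c k P a b x =
      ∫ p : (ℕ → ℝ) × (ℕ → ℝ), profit q c k P a b x p.1 p.2 ∂(noiseLaw μ w xi) := by
  rw [noiseLaw, integral_map (measurable_noise hCL.measurable_interarrival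
    hCL.measurable_claim).aemeasurable]
  · rfl
  · exact ((measurable_profit hq c k P a b).comp
      (measurable_const.prodMk measurable_id)).aestronglyMeasurable

lemma measurable_J [IsProbabilityMeasure μ] (hCL : IsCramerLundberg μ lam f w xi) (hq : 0 < q)
    (c k P a b : ℝ) : Measurable (J μ w xi q c k P a b) := by
  have hJ := funext (J_eq_integral_noiseLaw hCL hq c k P a b)
  have : IsProbabilityMeasure (noiseLaw μ w xi) := Measure.isProbabilityMeasure_map
    (measurable_noise hCL.measurable_interarrival hCL.measurable_claim).aemeasurable
  rw [hJ]
  exact (StronglyMeasurable.integral_prod_right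
    (f := fun x (p : (ℕ → ℝ) × (ℕ → ℝ)) => profit q c k P a b x p.1 p.2)
    (measurable_profit hq c k P a b).stronglyMeasurable).measurable

/-- The expected profit is bounded, uniformly over the levels below the barrier. -/
lemma exists_bound_J [IsProbabilityMeasure μ] (hCL : IsCramerLundberg μ lam f w xi)
    (hq : 0 < q) (hc : 0 < c) (hb : 0 ≤ b) (ha : 0 < a) (k P : ℝ) :
    ∃ C, ∀ x ≤ b, |J μ w xi q c k P a b x| ≤ C := by
  refine ⟨∫ ω, profitBound q c k P a b b *
    ∑' n, Real.exp (-q * claimTime (fun n => w n ω) n) ∂μ, fun x hx => ?_⟩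
  refine norm_integral_le_of_norm_le
    (f := fun ω => profit q c k P a b x (fun n => w n ω) (fun n => xi n ω)) ((integrable_tsum_discount hCL hq).1.const_mul _) ?_
  filter_upwards [ae_isRegularPath hCL hq] with ω h
  have hB : profitBound q c k P a b x = profitBound q c k P a b b := by
    rw [profitBound, profitBound, max_eq_right (sub_nonpos.2 hx), sub_self, max_self]
  exact hB ▸ abs_profit_le hq hc hb ha h

/-! ### The expected profit as a function of the initial surplus -/

lemma J_of_lt [IsProbabilityMeasure μ] (hx : x < -a) :
    J μ w xi q c k P a b x = -P := by
  simp [J, profit_of_lt hx]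

lemma J_of_mem_Ico [IsProbabilityMeasure μ] (hCL : IsCramerLundberg μ lam f w xi)
    (hq : 0 < q) (hc : 0 < c) (hb : 0 ≤ b) (ha : 0 < a) (hx : x ∈ Set.Ico (-a) 0) :
    J μ w xi q c k P a b x = k * x + J μ w xi q c k P a b 0 := by
  have h : J μ w xi q c k P a b x =
      ∫ ω, (k * x + profit q c k P a b 0 (fun n => w n ω) (fun n => xi n ω)) ∂μ :=
    integral_congr_ae ((ae_isRegularPath hCL hq).mono fun ω h =>
      profit_of_mem_Ico hq hc hb ha h hx)
  rw [h, integral_add (integrable_const _) (integrable_profit hCL hq hc hb ha 0)]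
  simp [J]

/-- The expected discounted dividends paid until the first claim. -/
noncomputable def firstDividends (μ : Measure Ω) (w xi : ℕ → Ω → ℝ) (q c b x : ℝ) : ℝ :=
  ∫ ω, (∫ t in (barrierTime c b x (fun n => w n ω) (fun n => xi n ω) 0)..(claimTime
    (fun n => w n ω) 1), c * Real.exp (-q * t)) ∂μ

/-- The measure of the step to the next claim: the interarrival time, weighted by the discount
factor over it, and the claim. -/
noncomputable def discountedStep (lam q : ℝ) (f : ℝ → ℝ) : Measure (ℝ × ℝ) :=
  (discountedExp lam q).prod (claimLaw f)

/-- The Markov property of the regulated surplus at the first claim. -/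
lemma J_eq_firstDividends_add [IsProbabilityMeasure μ] (hCL : IsCramerLundberg μ lam f w xi)
    (hq : 0 < q) (hc : 0 < c) (hb : 0 ≤ b) (ha : 0 < a) (hx : x ∈ Set.Icc 0 b) :
    J μ w xi q c k P a b x = firstDividends μ w xi q c b x +
      ∫ z, J μ w xi q c k P a b (min (x + c * z.1) b - z.2) ∂(discountedStep lam q f) := by
  have := isProbabilityMeasure_claimLaw hCL
  have := isProbabilityMeasure_expMeasure hCL.lam_pos
  have : IsProbabilityMeasure (noiseLaw μ w xi) := Measure.isProbabilityMeasure_map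
    (measurable_noise hCL.measurable_interarrival hCL.measurable_claim).aemeasurable
  have hx0 : -a ≤ x := by linarith [hx.1]
  let g : (ℝ × ℝ) × (ℕ → ℝ) × (ℕ → ℝ) → ℝ := fun z => Real.exp (-q * z.1.1) *
    profit q c k P a b (min (x + c * z.1.1) b - z.1.2) z.2.1 z.2.2
  have hg : Measurable g := by
    have h1 : Measurable fun z : (ℝ × ℝ) × (ℕ → ℝ) × (ℕ → ℝ) =>
        profit q c k P a b (min (x + c * z.1.1) b - z.1.2) z.2.1 z.2.2 :=
      (measurable_profit hq c k P a b).comp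
        (f := fun z : (ℝ × ℝ) × (ℕ → ℝ) × (ℕ → ℝ) => (min (x + c * z.1.1) b - z.1.2, z.2))
        (by fun_prop)
    exact Measurable.mul (by fun_prop) h1
  let φ : Ω → (ℝ × ℝ) × (ℕ → ℝ) × (ℕ → ℝ) := fun ω => ((w 0 ω, xi 0 ω),
    (fun n => w (n + 1) ω, fun n => xi (n + 1) ω))
  have hφ : Measurable φ :=
    ((hCL.measurable_interarrival 0).prodMk (hCL.measurable_claim 0)).prodMk
      (measurable_noise (fun n => hCL.measurable_interarrival (n + 1))
        (fun n => hCL.measurable_claim (n + 1)))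
  have hφmap : μ.map φ = ((expMeasure lam).prod (claimLaw f)).prod (noiseLaw μ w xi) :=
    map_first_shift hCL
  have hsplit : ∀ᵐ ω ∂μ, profit q c k P a b x (fun n => w n ω) (fun n => xi n ω) =
      (∫ t in (barrierTime c b x (fun n => w n ω) (fun n => xi n ω) 0)..(claimTime
        (fun n => w n ω) 1), c * Real.exp (-q * t)) + g (φ ω) := by
    filter_upwards [ae_isRegularPath hCL hq] with ω h
    rw [profit_eq_add_shift hq hc hb ha h hx0, profitTerm_zero_of_mem ha hx]
    simp only [level, regulate_of_mem hx]
    rfl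
  have hgint : Integrable (fun ω => g (φ ω)) μ := by
    -- `g ∘ φ` is the profit minus the bounded dividends up to the first claim.
    refine Integrable.mono' ((integrable_profit (k := k) (P := P) hCL hq hc hb ha x).abs.add
      (integrable_const (profitBound q c k P a b x))) (hg.comp hφ).aestronglyMeasurable ?_
    filter_upwards [ae_isRegularPath hCL hq, hsplit] with ω h hs
    have h0 := abs_profitTerm_le (k := k) (P := P) (x := x) hq hc hb ha h 0
    rw [profitTerm_zero_of_mem ha hx, claimTime_zero, mul_zero, Real.exp_zero, mul_one] at h0
    rw [eq_sub_of_add_eq' hs.symm]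
    exact (abs_sub _ _).trans (add_le_add_right h0 _)
  have hgint' : Integrable g (((expMeasure lam).prod (claimLaw f)).prod (noiseLaw μ w xi)) := by
    rw [← hφmap]
    exact (integrable_map_measure hg.aestronglyMeasurable hφ.aemeasurable).2 hgint
  have hdint : Integrable (fun ω => ∫ t in (barrierTime c b x (fun n => w n ω)
      (fun n => xi n ω) 0)..(claimTime (fun n => w n ω) 1), c * Real.exp (-q * t)) μ := by
    refine ((integrable_profit (k := k) (P := P) hCL hq hc hb ha x).sub hgint).congr ?_
    filter_upwards [hsplit] with ω h
    exact sub_eq_of_eq_add h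
  have hmain : ∫ ω, g (φ ω) ∂μ = ∫ z, J μ w xi q c k P a b (min (x + c * z.1) b - z.2)
      ∂(discountedStep lam q f) := by
    rw [← integral_map hφ.aemeasurable hg.aestronglyMeasurable, hφmap, integral_prod _ hgint',
      discountedStep, discountedExp, prod_withDensity_left (by fun_prop),
      integral_withDensity_eq_integral_toReal_smul (by fun_prop)
        (.of_forall fun _ => ENNReal.ofReal_lt_top)]
    refine integral_congr_ae (.of_forall fun z => ?_)
    simp only [g]
    rw [integral_const_mul, ← J_eq_integral_noiseLaw hCL hq,
      ENNReal.toReal_ofReal (Real.exp_pos _).le, smul_eq_mul]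
  rw [← hmain, firstDividends, ← integral_add hdint hgint]
  exact integral_congr_ae hsplit

end Law

/-! ### The discounted occupation measure before the first deficit -/

section Occupation

variable {c b : ℝ} {N : Measure (ℝ × ℝ)}

/-- The law of the level after the next claim, if the regulated surplus has law `R` now and the
interarrival time and the claim have law `N`. -/
noncomputable def nextLevel (c b : ℝ) (N : Measure (ℝ × ℝ)) (R : Measure ℝ) : Measure ℝ :=
  (R.prod N).map fun p => min (p.1 + c * p.2.1) b - p.2.2

/-- The law of the level after the `n`-th claim for the initial surplus `0`, on the event that
there has been no deficit, under the step measure `N`. -/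
noncomputable def survivalLaw (c b : ℝ) (N : Measure (ℝ × ℝ)) : ℕ → Measure ℝ
  | 0 => Measure.dirac 0
  | n + 1 => (nextLevel c b N (survivalLaw c b N n)).restrict (Set.Ici 0)

/-- The occupation measure of the levels after the claims, up to the first deficit, for the initial
surplus `0`. If `N` contains the discount factor, so does this measure. -/
noncomputable def occupation (c b : ℝ) (N : Measure (ℝ × ℝ)) : Measure ℝ :=
  Measure.sum (survivalLaw c b N)

lemma measurable_step (c b : ℝ) :
    Measurable fun p : ℝ × ℝ × ℝ => min (p.1 + c * p.2.1) b - p.2.2 := by fun_prop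

lemma nextLevel_univ [SFinite N] (R : Measure ℝ) :
    nextLevel c b N R Set.univ = R Set.univ * N Set.univ := by
  rw [nextLevel, Measure.map_apply (measurable_step c b) .univ, Set.preimage_univ,
    ← Set.univ_prod_univ, Measure.prod_prod]

lemma nextLevel_sum [SFinite N] (R : ℕ → Measure ℝ) :
    nextLevel c b N (Measure.sum R) = Measure.sum fun n => nextLevel c b N (R n) := by
  rw [nextLevel, Measure.prod_sum_left, Measure.map_sum (measurable_step c b).aemeasurable]
  rfl

lemma survivalLaw_univ_le [SFinite N] (n : ℕ) :
    survivalLaw c b N n Set.univ ≤ N Set.univ ^ n := by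
  induction n with
  | zero => simp [survivalLaw]
  | succ n ih =>
    rw [survivalLaw]
    refine (Measure.restrict_apply_le _ _).trans ?_
    rw [nextLevel_univ, pow_succ]
    gcongr

lemma isFiniteMeasure_occupation [SFinite N] (hN : N Set.univ < 1) :
    IsFiniteMeasure (occupation c b N) := by
  constructor
  rw [occupation, Measure.sum_apply _ .univ]
  refine (ENNReal.tsum_le_tsum survivalLaw_univ_le).trans_lt ?_
  rw [ENNReal.tsum_geometric, ENNReal.inv_lt_top]
  exact tsub_pos_of_lt hN

/-- The renewal equation of the occupation measure. -/
lemma occupation_eq [SFinite N] : occupation c b N =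
    Measure.dirac 0 + (nextLevel c b N (occupation c b N)).restrict (Set.Ici 0) := by
  rw [occupation, nextLevel_sum, Measure.restrict_sum _ measurableSet_Ici]
  ext s hs
  rw [Measure.add_apply, Measure.sum_apply _ hs, Measure.sum_apply _ hs,
    tsum_eq_zero_add' ENNReal.summable]
  rfl

lemma ae_nextLevel_le [SFinite N] (hN : ∀ᵐ p ∂N, 0 ≤ p.2) (R : Measure ℝ) :
    ∀ᵐ z ∂(nextLevel c b N R), z ≤ b := by
  rw [nextLevel, ae_map_iff (measurable_step c b).aemeasurable measurableSet_Iic]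
  have h : ∀ᵐ p ∂(R.prod N), 0 ≤ p.2.2 := Measure.quasiMeasurePreserving_snd.ae hN
  filter_upwards [h] with p hp
  linarith [min_le_right (p.1 + c * p.2.1) b]

lemma ae_occupation_mem [SFinite N] (hb : 0 ≤ b) (hN : ∀ᵐ p ∂N, 0 ≤ p.2) :
    ∀ᵐ x ∂(occupation c b N), x ∈ Set.Icc 0 b := by
  rw [occupation_eq, ae_add_measure_iff]
  constructor
  · rw [ae_dirac_eq]; exact ⟨le_rfl, hb⟩
  · filter_upwards [ae_restrict_mem measurableSet_Ici,
      ae_restrict_of_ae (ae_nextLevel_le hN _)] with x h1 h2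
    exact ⟨h1, h2⟩

lemma isFiniteMeasure_nextLevel [IsFiniteMeasure N] (R : Measure ℝ) [IsFiniteMeasure R] :
    IsFiniteMeasure (nextLevel c b N R) := by
  rw [nextLevel]; infer_instance

/-- The expected discount factor at the first deficit is less than `1`. -/
lemma nextLevel_occupation_Iio_lt_one [IsFiniteMeasure N] (hN : N Set.univ < 1) :
    (nextLevel c b N (occupation c b N)).real (Set.Iio 0) < 1 := by
  have := isFiniteMeasure_occupation (c := c) (b := b) hN
  have := isFiniteMeasure_nextLevel (c := c) (b := b) (N := N) (occupation c b N)
  set R := occupation c b N with hR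
  set Q := nextLevel c b N R with hQ
  have h1 : R.real Set.univ = 1 + Q.real (Set.Ici 0) := by
    have h : R Set.univ = 1 + Q (Set.Ici 0) := by
      conv_lhs => rw [hR, occupation_eq]
      simp [hQ, hR]
    rw [Measure.real, h, ENNReal.toReal_add ENNReal.one_ne_top (measure_ne_top _ _)]
    simp [Measure.real]
  have h2 : Q.real Set.univ = R.real Set.univ * N.real Set.univ := by
    rw [Measure.real, hQ, nextLevel_univ, ENNReal.toReal_mul]; rfl
  have h3 : Q.real (Set.Ici 0) + Q.real (Set.Iio 0) = Q.real Set.univ := by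
    rw [← Set.compl_Ici]; exact measureReal_add_measureReal_compl measurableSet_Ici
  have h4 : N.real Set.univ < 1 := by
    rw [Measure.real, ← ENNReal.toReal_one]
    exact (ENNReal.toReal_lt_toReal hN.ne_top ENNReal.one_ne_top).2 hN
  have h5 : 0 ≤ Q.real (Set.Ici 0) := measureReal_nonneg
  nlinarith

/-- A solution `v` of the one-step equation with running reward `H` is, at `0`, the reward
accumulated up to the first deficit plus the value at the first deficit. -/
lemma eq_integral_occupation_add [IsFiniteMeasure N] (hN1 : N Set.univ < 1) (hb : 0 ≤ b)
    (hN : ∀ᵐ p ∂N, 0 ≤ p.2) {v H : ℝ → ℝ} (hv : Measurable v) {C : ℝ}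
    (hC : ∀ x ≤ b, |v x| ≤ C)
    (hstep : ∀ x ∈ Set.Icc 0 b, v x = H x + ∫ p, v (min (x + c * p.1) b - p.2) ∂N) :
    v 0 = ∫ x, H x ∂(occupation c b N) +
      ∫ z in Set.Iio 0, v z ∂(nextLevel c b N (occupation c b N)) := by
  have := isFiniteMeasure_occupation (c := c) (b := b) hN1
  have := isFiniteMeasure_nextLevel (c := c) (b := b) (N := N) (occupation c b N)
  have hvQ : Integrable v (nextLevel c b N (occupation c b N)) :=
    Integrable.of_bound hv.aestronglyMeasurable C
      ((ae_nextLevel_le hN _).mono fun z hz => hC z hz)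
  have hmem := ae_occupation_mem (c := c) (N := N) hb hN
  have hvR : Integrable v (occupation c b N) :=
    Integrable.of_bound hv.aestronglyMeasurable C (hmem.mono fun z hz => hC z hz.2)
  have hprod : Integrable (fun p : ℝ × ℝ × ℝ => v (min (p.1 + c * p.2.1) b - p.2.2))
      ((occupation c b N).prod N) :=
    (integrable_map_measure hv.aestronglyMeasurable (measurable_step c b).aemeasurable).1 hvQ
  have hQ : ∫ z, v z ∂(nextLevel c b N (occupation c b N)) =
      ∫ x, ∫ p, v (min (x + c * p.1) b - p.2) ∂N ∂(occupation c b N) := by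
    rw [nextLevel, integral_map (measurable_step c b).aemeasurable hv.aestronglyMeasurable,
      integral_prod _ hprod]
  have hK := hprod.integral_prod_left
  have hH : ∫ x, H x ∂(occupation c b N) = ∫ x, v x ∂(occupation c b N) -
      ∫ z, v z ∂(nextLevel c b N (occupation c b N)) := by
    rw [hQ, ← integral_sub hvR hK]
    exact integral_congr_ae (hmem.mono fun x hx => eq_sub_of_add_eq (hstep x hx).symm)
  have hR : ∫ x, v x ∂(occupation c b N) =
      v 0 + ∫ z in Set.Ici 0, v z ∂(nextLevel c b N (occupation c b N)) := by
    conv_lhs => rw [occupation_eq]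
    rw [integral_add_measure (integrable_dirac (by finiteness)) hvQ.restrict, integral_dirac]
  have hsplit := integral_add_compl (measurableSet_Ici (a := (0 : ℝ))) hvQ
  rw [Set.compl_Ici] at hsplit
  linarith

end Occupation

/-! ### Continuity of averages of an integrable function over translates -/

section Translation

open Filter Topology

/-- Translation is continuous in `L¹(ℝ)`. -/
lemma tendsto_integral_norm_translate_sub {g : ℝ → ℝ} (hg : Integrable g) (a : ℝ) :
    Tendsto (fun u => ∫ m, ‖g (m + u) - g (m + a)‖) (𝓝 a) (𝓝 0) := by
  let T : C(ℝ, C(ℝ, ℝ)) := (ContinuousMap.mk (fun p : ℝ × ℝ => p.2 + p.1)).curry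
  have hT : ∀ u, MeasurePreserving (T u) volume volume := fun u =>
    measurePreserving_add_right volume u
  have h := (ContinuousAt.compMeasurePreservingLp (p := 1) (f := fun _ : ℝ => hg.toL1 g) (g := T)
    (z := a) continuousAt_const T.continuous.continuousAt hT ENNReal.one_ne_top)
  have h2 := tendsto_iff_norm_sub_tendsto_zero.1 h
  refine h2.congr fun u => ?_
  rw [L1.norm_eq_integral_norm]
  refine integral_congr_ae ?_
  have h3 : ∀ v, Lp.compMeasurePreserving (T v) (hT v) (hg.toL1 g) =ᵐ[volume]
      fun m => g (m + v) := fun v =>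
    (Lp.coeFn_compMeasurePreserving _ (hT v)).trans
      ((hT v).quasiMeasurePreserving.ae_eq_comp hg.coeFn_toL1)
  filter_upwards [Lp.coeFn_sub (Lp.compMeasurePreserving (T u) (hT u) (hg.toL1 g))
    (Lp.compMeasurePreserving (T a) (hT a) (hg.toL1 g)), h3 u, h3 a] with m h4 h5 h6
  rw [h4, Pi.sub_apply, h5, h6]

lemma integrable_translate_of_le {g : ℝ → ℝ} (hg : Integrable g) {M : Measure ℝ} {C : ENNReal}
    (hC : C ≠ ⊤) (hM : M ≤ C • volume) (u : ℝ) : Integrable (fun m => g (m + u)) M :=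
  ((hg.comp_add_right u).smul_measure hC).mono_measure hM

/-- If `M` has a bounded density, then its convolution with an integrable function is
continuous. -/
lemma continuous_integral_translate_of_le {g : ℝ → ℝ} (hg : Integrable g) {M : Measure ℝ}
    {C : ENNReal} (hC : C ≠ ⊤) (hM : M ≤ C • volume) :
    Continuous fun u => ∫ m, g (m + u) ∂M := by
  refine continuous_iff_continuousAt.2 fun a => ?_
  rw [ContinuousAt, tendsto_iff_norm_sub_tendsto_zero]
  have h := (tendsto_integral_norm_translate_sub hg a).const_mul C.toReal
  rw [mul_zero] at h
  refine squeeze_zero (fun _ => norm_nonneg _) (fun u => ?_) h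
  have hi := integrable_translate_of_le hg hC hM
  rw [← integral_sub (hi u) (hi a)]
  refine (norm_integral_le_integral_norm _).trans ?_
  rw [← smul_eq_mul, ← integral_smul_measure]
  exact integral_mono_measure hM (.of_forall fun _ => norm_nonneg _)
    ((((hg.comp_add_right u).sub (hg.comp_add_right a)).norm).smul_measure hC)

end Translation

/-! ### The density of the deficit -/

section Deficit

variable {c b lam q : ℝ} {f : ℝ → ℝ}

/-- The law of the level just before the next claim, if the regulated surplus has law `R` now and
the interarrival time has law `η`. -/
noncomputable def preClaim (c b : ℝ) (η R : Measure ℝ) : Measure ℝ :=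
  (R.prod η).map fun p => min (p.1 + c * p.2) b

lemma measurable_preClaim_step (c b : ℝ) : Measurable fun p : ℝ × ℝ => min (p.1 + c * p.2) b := by
  fun_prop

lemma isFiniteMeasure_preClaim (η R : Measure ℝ) [IsFiniteMeasure η] [IsFiniteMeasure R] :
    IsFiniteMeasure (preClaim c b η R) := by
  rw [preClaim]; infer_instance

lemma nextLevel_prod_apply {η R ζ : Measure ℝ} [SFinite η] [SFinite R] [SFinite ζ] {A : Set ℝ}
    (hA : MeasurableSet A) : nextLevel c b (η.prod ζ) R A =
      ∫⁻ m, ζ ((fun y => m - y) ⁻¹' A) ∂(preClaim c b η R) := by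
  have h1 : Measurable fun m => ζ ((fun y => m - y) ⁻¹' A) :=
    measurable_measure_prodMk_left (ν := ζ) (s := (fun p : ℝ × ℝ => p.1 - p.2) ⁻¹' A)
      ((by fun_prop : Measurable fun p : ℝ × ℝ => p.1 - p.2) hA)
  rw [nextLevel, Measure.map_apply (measurable_step c b) hA,
    Measure.prod_apply (measurable_step c b hA), preClaim,
    lintegral_map h1 (measurable_preClaim_step c b),
    lintegral_prod (fun p : ℝ × ℝ => ζ ((fun y => min (p.1 + c * p.2) b - y) ⁻¹' A))
      (h1.comp (measurable_preClaim_step c b)).aemeasurable]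
  refine lintegral_congr fun x => ?_
  rw [Measure.prod_apply (measurable_prodMk_left (measurable_step c b hA))]
  rfl

lemma ae_preClaim_le (η R : Measure ℝ) : ∀ᵐ m ∂(preClaim c b η R), m ≤ b := by
  rw [preClaim, ae_map_iff (measurable_preClaim_step c b).aemeasurable measurableSet_Iic]
  exact .of_forall fun p => min_le_right _ _

/-- Strictly below the barrier the level before a claim has a bounded density, because the
interarrival time has one. -/
lemma preClaim_restrict_le (hlam : 0 < lam) (hq : 0 < q) (hc : 0 < c) (R : Measure ℝ)
    [IsFiniteMeasure R] : (preClaim c b (discountedExp lam q) R).restrict (Set.Iio b) ≤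
      (R Set.univ * (ENNReal.ofReal lam * ENNReal.ofReal |c⁻¹|)) • volume := by
  have := isFiniteMeasure_discountedExp hlam hq
  refine Measure.le_intro fun A hA _ => ?_
  rw [Measure.restrict_apply hA, preClaim,
    Measure.map_apply (measurable_preClaim_step c b) (hA.inter measurableSet_Iio)]
  have hsub : (fun p : ℝ × ℝ => min (p.1 + c * p.2) b) ⁻¹' (A ∩ Set.Iio b) ⊆
      (fun p : ℝ × ℝ => p.1 + c * p.2) ⁻¹' A := by
    rintro p ⟨h1, h2⟩
    have h3 : p.1 + c * p.2 < b := by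
      by_contra hcon
      exact absurd (show min (p.1 + c * p.2) b < b from h2)
        (by rw [min_eq_right (not_lt.1 hcon)]; exact lt_irrefl b)
    rwa [Set.mem_preimage, ← min_eq_left h3.le]
  have hm : Measurable fun p : ℝ × ℝ => p.1 + c * p.2 := by fun_prop
  refine (measure_mono hsub).trans ?_
  rw [Measure.prod_apply (hm hA)]
  have hle : ∀ x, discountedExp lam q (Prod.mk x ⁻¹' ((fun p : ℝ × ℝ => p.1 + c * p.2) ⁻¹' A)) ≤
      ENNReal.ofReal lam * (ENNReal.ofReal |c⁻¹| * volume A) := by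
    intro x
    refine (discountedExp_le hlam hq _).trans_eq ?_
    rw [Measure.smul_apply, smul_eq_mul]
    congr 1
    have : Prod.mk x ⁻¹' ((fun p : ℝ × ℝ => p.1 + c * p.2) ⁻¹' A) =
      (fun s => c * s) ⁻¹' ((fun y => x + y) ⁻¹' A) := rfl
    rw [this, Real.volume_preimage_mul_left hc.ne', measure_preimage_add]
  refine (lintegral_mono hle).trans_eq ?_
  rw [lintegral_const, Measure.smul_apply, smul_eq_mul]
  ring

/-- The barrier is reached from `0` before the next claim with positive probability. -/
lemma preClaim_singleton_pos (hlam : 0 < lam) (hq : 0 < q) (hc : 0 < c) (hb : 0 ≤ b)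
    {R : Measure ℝ} [IsFiniteMeasure R] (hR : R {0} ≠ 0) :
    preClaim c b (discountedExp lam q) R {b} ≠ 0 := by
  have := isFiniteMeasure_discountedExp hlam hq
  rw [preClaim, Measure.map_apply (measurable_preClaim_step c b) (measurableSet_singleton b)]
  intro h0
  have hsub : ({0} : Set ℝ) ×ˢ Set.Ioi (b / c) ⊆
      (fun p : ℝ × ℝ => min (p.1 + c * p.2) b) ⁻¹' {b} := by
    rintro ⟨x, s⟩ ⟨hx, hs⟩
    have h1 : x = 0 := hx
    have h2 : b < s * c := (div_lt_iff₀ hc).1 hs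
    simp only [Set.mem_preimage, Set.mem_singleton_iff, h1, zero_add]
    exact min_eq_right (by linarith)
  have h1 := measure_mono_null hsub h0
  rw [Measure.prod_prod, mul_eq_zero, or_iff_right hR] at h1
  have h2 := absolutelyContinuous_discountedExp hlam q h1
  rw [Measure.restrict_apply measurableSet_Ioi, Set.inter_eq_left.2
    (Set.Ioi_subset_Ioi (div_nonneg hb hc.le)), Real.volume_Ioi] at h2
  exact ENNReal.top_ne_zero h2

/-- Every set of positive length below the barrier is visited just before a claim. -/
lemma absolutelyContinuous_preClaim (hlam : 0 < lam) (hq : 0 < q) (hc : 0 < c)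
    {R : Measure ℝ} [IsFiniteMeasure R] (hR : R {0} ≠ 0) :
    volume.restrict (Set.Ioo 0 b) ≪
      (preClaim c b (discountedExp lam q) R).restrict (Set.Iio b) := by
  have := isFiniteMeasure_discountedExp hlam hq
  refine Measure.AbsolutelyContinuous.mk fun A hA h0 => ?_
  rw [Measure.restrict_apply hA, preClaim,
    Measure.map_apply (measurable_preClaim_step c b) (hA.inter measurableSet_Iio)] at h0
  have hsub : ({0} : Set ℝ) ×ˢ ((fun s => c * s) ⁻¹' (A ∩ Set.Ioo 0 b)) ⊆
      (fun p : ℝ × ℝ => min (p.1 + c * p.2) b) ⁻¹' (A ∩ Set.Iio b) := by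
    rintro ⟨x, s⟩ ⟨hx, hs⟩
    have h1 : x = 0 := hx
    have h2 : c * s ∈ A ∩ Set.Ioo 0 b := hs
    simp only [Set.mem_preimage, h1, zero_add, min_eq_left h2.2.2.le]
    exact ⟨h2.1, h2.2.2⟩
  have h1 := measure_mono_null hsub h0
  rw [Measure.prod_prod, mul_eq_zero, or_iff_right hR] at h1
  have h2 := absolutelyContinuous_discountedExp hlam q h1
  have h3 : (fun s => c * s) ⁻¹' (A ∩ Set.Ioo 0 b) ⊆ Set.Ioi 0 := fun s hs =>
    pos_of_mul_pos_right hs.2.1 hc.le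
  have hm : Measurable fun s : ℝ => c * s := by fun_prop
  rw [Measure.restrict_apply (hm (hA.inter measurableSet_Ioo)), Set.inter_eq_left.2 h3,
    Real.volume_preimage_mul_left hc.ne', mul_eq_zero, or_iff_right] at h2
  · rwa [Measure.restrict_apply hA]
  · exact (ENNReal.ofReal_pos.2 (abs_pos.2 (inv_ne_zero hc.ne'))).ne'

/-- The claim density, extended by `0` to the whole line. -/
noncomputable def claimDensity (f : ℝ → ℝ) : ℝ → ℝ := (Set.Ioi 0).indicator f

lemma measurable_claimDensity (hf : Measurable f) : Measurable (claimDensity f) :=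
  hf.indicator measurableSet_Ioi

lemma claimDensity_nonneg (h0 : ∀ u, 0 < u → 0 ≤ f u) (u : ℝ) : 0 ≤ claimDensity f u :=
  Set.indicator_nonneg (fun u hu => h0 u hu) u

lemma claimDensity_of_pos {u : ℝ} (hu : 0 < u) : claimDensity f u = f u :=
  Set.indicator_of_mem (Set.mem_Ioi.2 hu) f

lemma claimLaw_eq (f : ℝ → ℝ) :
    claimLaw f = volume.withDensity fun u => ENNReal.ofReal (claimDensity f u) := by
  rw [claimLaw, ← withDensity_indicator measurableSet_Ioi]
  congr 1
  funext u
  by_cases hu : u ∈ Set.Ioi (0 : ℝ) <;> simp [claimDensity, hu]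

lemma integrable_claimDensity (hf : Measurable f) (h0 : ∀ u, 0 < u → 0 ≤ f u)
    [IsFiniteMeasure (claimLaw f)] : Integrable (claimDensity f) := by
  refine ⟨(measurable_claimDensity hf).aestronglyMeasurable, ?_⟩
  rw [hasFiniteIntegral_iff_ofReal (.of_forall (claimDensity_nonneg h0))]
  have h := measure_lt_top (claimLaw f) Set.univ
  rwa [claimLaw_eq, withDensity_apply _ .univ, Measure.restrict_univ] at h

/-- The density at `u` of the size of the deficit, if the level before the claim has
law `M`. -/
noncomputable def deficitDensity (f : ℝ → ℝ) (M : Measure ℝ) (u : ℝ) : ℝ :=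
  ∫ m, claimDensity f (m + u) ∂M

lemma lintegral_claimLaw_Ico (hf : Measurable f) (M : Measure ℝ) [IsFiniteMeasure M] (t : ℝ) :
    ∫⁻ m, claimLaw f ((fun y => m - y) ⁻¹' Set.Ico (-t) 0) ∂M =
      ∫⁻ u in Set.Ioc 0 t, ∫⁻ m, ENNReal.ofReal (claimDensity f (m + u)) ∂M := by
  have hg := measurable_claimDensity hf
  rw [lintegral_lintegral_swap (by fun_prop)]
  refine lintegral_congr fun m => ?_
  have hset : (fun y => m - y) ⁻¹' Set.Ico (-t) 0 = Set.Ioc m (m + t) := by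
    ext y
    simp only [Set.mem_preimage, Set.mem_Ico, Set.mem_Ioc]
    constructor <;> rintro ⟨h1, h2⟩ <;> constructor <;> linarith
  rw [hset, claimLaw_eq, withDensity_apply _ measurableSet_Ioc,
    ← lintegral_indicator measurableSet_Ioc, ← lintegral_indicator measurableSet_Ioc,
    ← lintegral_add_left_eq_self _ m]
  refine lintegral_congr fun u => ?_
  simp only [Set.indicator, Set.mem_Ioc]
  congr 1
  simp

lemma toReal_lintegral_claimDensity (hf : Measurable f) (h0 : ∀ u, 0 < u → 0 ≤ f u)
    (M : Measure ℝ) (u : ℝ) :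
    (∫⁻ m, ENNReal.ofReal (claimDensity f (m + u)) ∂M).toReal = deficitDensity f M u := by
  have hg := measurable_claimDensity hf
  rw [deficitDensity, integral_eq_lintegral_of_nonneg_ae
    (.of_forall fun m => claimDensity_nonneg h0 _)
    (Measurable.aestronglyMeasurable (by fun_prop))]

lemma measurable_deficitDensity (hf : Measurable f) (M : Measure ℝ) [IsFiniteMeasure M] :
    Measurable (deficitDensity f M) := by
  have hg := measurable_claimDensity hf
  exact (StronglyMeasurable.integral_prod_right (f := fun u m => claimDensity f (m + u))
    (Measurable.stronglyMeasurable (by simp only [Function.uncurry_def]; fun_prop))).measurable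

/-- The law of the deficit has the density `deficitDensity`. -/
lemma nextLevel_real_Ico (hf : Measurable f) (h0 : ∀ u, 0 < u → 0 ≤ f u) {η R : Measure ℝ}
    [IsFiniteMeasure η] [IsFiniteMeasure R] [IsFiniteMeasure (claimLaw f)]
    {t : ℝ} (ht : 0 ≤ t) :
    IntervalIntegrable (deficitDensity f (preClaim c b η R)) volume 0 t ∧
    (nextLevel c b (η.prod (claimLaw f)) R).real (Set.Ico (-t) 0) =
      ∫ u in (0)..t, deficitDensity f (preClaim c b η R) u := by
  have := isFiniteMeasure_preClaim (c := c) (b := b) η R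
  have := isFiniteMeasure_nextLevel (c := c) (b := b) (N := η.prod (claimLaw f)) R
  have hg := measurable_claimDensity hf
  have hm : Measurable fun u =>
      ∫⁻ m, ENNReal.ofReal (claimDensity f (m + u)) ∂(preClaim c b η R) :=
    Measurable.lintegral_prod_right' (f := fun p : ℝ × ℝ =>
      ENNReal.ofReal (claimDensity f (p.2 + p.1))) (by fun_prop)
  have h1 : nextLevel c b (η.prod (claimLaw f)) R (Set.Ico (-t) 0) =
      ∫⁻ u in Set.Ioc 0 t,
        ∫⁻ m, ENNReal.ofReal (claimDensity f (m + u)) ∂(preClaim c b η R) := by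
    rw [nextLevel_prod_apply measurableSet_Ico, lintegral_claimLaw_Ico hf]
  have hfin : ∫⁻ u in Set.Ioc 0 t,
      ∫⁻ m, ENNReal.ofReal (claimDensity f (m + u)) ∂(preClaim c b η R) ≠ ⊤ :=
    h1 ▸ measure_ne_top _ _
  have hcongr := funext (toReal_lintegral_claimDensity hf h0 (preClaim c b η R))
  constructor
  · rw [intervalIntegrable_iff_integrableOn_Ioc_of_le ht, ← hcongr]
    exact integrable_toReal_of_lintegral_ne_top hm.aemeasurable hfin
  · rw [intervalIntegral.integral_of_le ht, ← hcongr, integral_toReal hm.aemeasurable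
      (ae_lt_top hm hfin), Measure.real, h1]

/-- Decomposition of the deficit density according to whether the claim occurs at the barrier. -/
lemma deficitDensity_eq (hf : Measurable f) (h0 : ∀ u, 0 < u → 0 ≤ f u)
    [IsFiniteMeasure (claimLaw f)] {M : Measure ℝ} [IsFiniteMeasure M]
    (hM : ∀ᵐ m ∂M, m ≤ b) {C : ENNReal} (hC : C ≠ ⊤) (hMC : M.restrict (Set.Iio b) ≤ C • volume)
    (u : ℝ) : deficitDensity f M u = ∫ m in Set.Iio b, claimDensity f (m + u) ∂M +
      M.real {b} * claimDensity f (b + u) := by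
  have hg := integrable_claimDensity hf h0
  have hM' : M = M.restrict (Set.Iio b) + M.restrict {b} := by
    rw [← Measure.restrict_union (by simp) (measurableSet_singleton b), Set.Iio_union_right]
    exact (Measure.restrict_eq_self_of_ae_mem hM).symm
  rw [deficitDensity]
  conv_lhs => rw [hM']
  rw [integral_add_measure (integrable_translate_of_le hg hC hMC u)]
  · simp [Measure.real]
  · rw [Measure.restrict_singleton]
    exact (integrable_dirac (by finiteness)).smul_measure (measure_ne_top _ _)

lemma continuousAt_deficitDensity {a : ℝ} (hf : Measurable f) (h0 : ∀ u, 0 < u → 0 ≤ f u)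
    [IsFiniteMeasure (claimLaw f)] {M : Measure ℝ} [IsFiniteMeasure M]
    (hM : ∀ᵐ m ∂M, m ≤ b) {C : ENNReal} (hC : C ≠ ⊤) (hMC : M.restrict (Set.Iio b) ≤ C • volume)
    (hab : 0 < a + b) (hcont : ContinuousAt f (a + b)) :
    ContinuousAt (deficitDensity f M) a := by
  rw [funext (deficitDensity_eq hf h0 hM hC hMC)]
  have h1 : ContinuousAt (claimDensity f) (b + a) := by
    rw [add_comm]
    refine hcont.congr ?_
    filter_upwards [lt_mem_nhds hab] with u hu
    exact (claimDensity_of_pos hu).symm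
  refine ContinuousAt.add (continuous_integral_translate_of_le
    (integrable_claimDensity hf h0) hC hMC).continuousAt (continuousAt_const.mul ?_)
  exact h1.comp (f := fun u => b + u) (by fun_prop)

lemma deficitDensity_pos {a : ℝ} (ha : 0 < a) (hb : 0 ≤ b) (hf : Measurable f)
    (h0 : ∀ u, 0 < u → 0 ≤ f u)
    [IsFiniteMeasure (claimLaw f)] {M : Measure ℝ} [IsFiniteMeasure M]
    (hM : ∀ᵐ m ∂M, m ≤ b) {C : ENNReal} (hC : C ≠ ⊤) (hMC : M.restrict (Set.Iio b) ≤ C • volume)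
    (hMb : M {b} ≠ 0) (hac : volume.restrict (Set.Ioo 0 b) ≪ M.restrict (Set.Iio b))
    (hpos : 0 < f (a + b) ∨ 0 < ∫ u in a..(a + b), f u) : 0 < deficitDensity f M a := by
  have hg0 := claimDensity_nonneg h0
  have hI : 0 ≤ ∫ m in Set.Iio b, claimDensity f (m + a) ∂M := integral_nonneg fun m => hg0 _
  have hB : 0 < M.real {b} := ENNReal.toReal_pos hMb (measure_ne_top _ _)
  rw [deficitDensity_eq hf h0 hM hC hMC]
  rcases hpos with h | h
  · rw [add_comm b a, claimDensity_of_pos (by linarith)]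
    have := mul_pos hB h
    linarith
  · refine add_pos_of_pos_of_nonneg (lt_of_le_of_ne hI fun heq => ?_) (mul_nonneg hB.le (hg0 _))
    have hae := (integral_eq_zero_iff_of_nonneg (fun m => hg0 (m + a))
      (integrable_translate_of_le (integrable_claimDensity hf h0) hC hMC a)).1 heq.symm
    have hae' := hac.ae_le hae
    have hzero : ∫ u in a..(a + b), f u = 0 := by
      have hshift := intervalIntegral.integral_comp_add_right (a := 0) (b := b) f a
      rw [zero_add, add_comm b a] at hshift
      rw [← hshift, intervalIntegral.integral_of_le hb, integral_Ioc_eq_integral_Ioo]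
      refine integral_eq_zero_of_ae ?_
      filter_upwards [hae', ae_restrict_mem measurableSet_Ioo] with m h1 h2
      rw [← claimDensity_of_pos (f := f) (by linarith [h2.1] : 0 < m + a)]
      exact h1
    exact h.ne' hzero

end Deficit

/-! ### Differentiation in the bankruptcy threshold -/

section Derivative

open Filter Topology

variable {Ω : Type*} [MeasurableSpace Ω] {μ : Measure Ω}
  {lam : ℝ} {f : ℝ → ℝ} {w xi : ℕ → Ω → ℝ} {q c k P a b : ℝ}

/-- The discounted occupation measure of the levels after the claims, the level at the first deficit
included, for the initial surplus `0`. Its restriction to `(-∞, 0)` is the discounted law of the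
level at the first deficit. -/
noncomputable def firstDeficit (lam q c b : ℝ) (f : ℝ → ℝ) : Measure ℝ :=
  nextLevel c b (discountedStep lam q f) (occupation c b (discountedStep lam q f))

lemma isFiniteMeasure_discountedStep [IsProbabilityMeasure (claimLaw f)] (hlam : 0 < lam)
    (hq : 0 < q) : IsFiniteMeasure (discountedStep lam q f) := by
  have := isFiniteMeasure_discountedExp hlam hq
  rw [discountedStep]; infer_instance

lemma discountedStep_univ_lt_one [IsProbabilityMeasure (claimLaw f)] (hlam : 0 < lam)
    (hq : 0 < q) : discountedStep lam q f Set.univ < 1 := by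
  have := isFiniteMeasure_discountedExp hlam hq
  rw [discountedStep, ← Set.univ_prod_univ, Measure.prod_prod, measure_univ (μ := claimLaw f), mul_one]
  exact discountedExp_univ_lt_one hlam hq

lemma isFiniteMeasure_firstDeficit [IsProbabilityMeasure (claimLaw f)] (hlam : 0 < lam)
    (hq : 0 < q) : IsFiniteMeasure (firstDeficit lam q c b f) := by
  have := isFiniteMeasure_discountedStep (f := f) hlam hq
  have := isFiniteMeasure_occupation (c := c) (b := b) (discountedStep_univ_lt_one (f := f) hlam hq)
  exact isFiniteMeasure_nextLevel _

/-- The value at `0` splits at the first deficit: a deficit of size at most `a` is covered and the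
path restarts from `0`, a larger one leads to bankruptcy. -/
lemma J_zero_eq [IsProbabilityMeasure μ] (hCL : IsCramerLundberg μ lam f w xi)
    (hq : 0 < q) (hc : 0 < c) (hb : 0 ≤ b) (ha : 0 < a) :
    J μ w xi q c k P a b 0 * (1 - (firstDeficit lam q c b f).real (Set.Ico (-a) 0)) =
      ∫ x, firstDividends μ w xi q c b x ∂(occupation c b (discountedStep lam q f)) -
      k * ∫ z in Set.Ico (-a) 0, -z ∂(firstDeficit lam q c b f) -
      P * ((firstDeficit lam q c b f).real (Set.Iio 0) -
        (firstDeficit lam q c b f).real (Set.Ico (-a) 0)) := by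
  have := isProbabilityMeasure_claimLaw hCL
  have := isFiniteMeasure_discountedExp hCL.lam_pos hq
  have := isFiniteMeasure_discountedStep (f := f) hCL.lam_pos hq
  have := isFiniteMeasure_firstDeficit (f := f) (c := c) (b := b) hCL.lam_pos hq
  have hN : ∀ᵐ p ∂(discountedStep lam q f), 0 ≤ p.2 :=
    (Measure.quasiMeasurePreserving_snd.ae (ae_pos_claimLaw f)).mono fun p hp => hp.le
  obtain ⟨C, hC⟩ := exists_bound_J hCL hq hc hb ha k P
  have h := eq_integral_occupation_add (discountedStep_univ_lt_one hCL.lam_pos hq) hb hN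
    (measurable_J hCL hq c k P a b) hC
    (fun x hx => J_eq_firstDividends_add hCL hq hc hb ha hx)
  change _ = _ + ∫ z in Set.Iio 0, _ ∂(firstDeficit lam q c b f) at h
  set Q := firstDeficit lam q c b f with hQ
  have hsplit : Set.Iio (0 : ℝ) = Set.Iio (-a) ∪ Set.Ico (-a) 0 :=
    (Set.Iio_union_Ico_eq_Iio (by linarith)).symm
  have hdisj : Disjoint (Set.Iio (-a)) (Set.Ico (-a) 0) :=
    Set.disjoint_left.2 fun z h1 h2 => not_le.2 h1 h2.1
  have hJQ : IntegrableOn (J μ w xi q c k P a b) (Set.Iio 0) Q :=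
    Integrable.of_bound (measurable_J hCL hq c k P a b).aestronglyMeasurable C
      ((ae_restrict_mem measurableSet_Iio).mono fun z hz => hC z ((le_of_lt hz).trans hb))
  have hneg : IntegrableOn (fun z => -z) (Set.Ico (-a) 0) Q := by
    refine Integrable.of_bound (by fun_prop) a ?_
    filter_upwards [ae_restrict_mem measurableSet_Ico] with z hz
    rw [norm_neg, Real.norm_eq_abs, abs_le]
    constructor <;> linarith [hz.1, hz.2]
  have h1 : ∫ z in Set.Iio (-a), J μ w xi q c k P a b z ∂Q = -P * Q.real (Set.Iio (-a)) := by
    rw [setIntegral_congr_fun measurableSet_Iio fun z hz => J_of_lt hz]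
    simp [mul_comm]
  have h2 : ∫ z in Set.Ico (-a) 0, J μ w xi q c k P a b z ∂Q =
      J μ w xi q c k P a b 0 * Q.real (Set.Ico (-a) 0) - k * ∫ z in Set.Ico (-a) 0, -z ∂Q := by
    rw [setIntegral_congr_fun (g := fun z => J μ w xi q c k P a b 0 - k * -z) measurableSet_Ico
      fun z hz => by rw [J_of_mem_Ico hCL hq hc hb ha hz]; ring,
      integral_sub (integrable_const _) (hneg.const_mul k), integral_const_mul]
    simp [mul_comm]
  have h3 : Q.real (Set.Iio 0) = Q.real (Set.Iio (-a)) + Q.real (Set.Ico (-a) 0) := by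
    rw [hsplit, measureReal_union hdisj measurableSet_Ico]
  rw [hsplit, setIntegral_union hdisj measurableSet_Ico (hJQ.mono_set (by rw [hsplit]; simp))
    (hJQ.mono_set (by rw [hsplit]; simp)), h1, h2] at h
  rw [h3]
  linear_combination h

lemma firstDeficit_real_Ico_lt_one [IsProbabilityMeasure (claimLaw f)] (hlam : 0 < lam)
    (hq : 0 < q) (t : ℝ) : (firstDeficit lam q c b f).real (Set.Ico (-t) 0) < 1 := by
  have := isFiniteMeasure_discountedStep (f := f) hlam hq
  have := isFiniteMeasure_firstDeficit (f := f) (c := c) (b := b) hlam hq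
  exact (measureReal_mono fun z hz => hz.2).trans_lt
    (nextLevel_occupation_Iio_lt_one (discountedStep_univ_lt_one hlam hq))

/-- The discounted law of the size of the first deficit has a positive derivative at `a`. -/
lemma exists_hasDerivAt_firstDeficit [IsProbabilityMeasure (claimLaw f)] (hlam : 0 < lam)
    (hq : 0 < q) (hc : 0 < c) (ha : 0 < a) (hb : 0 ≤ b) (hf : Measurable f)
    (h0 : ∀ u, 0 < u → 0 ≤ f u) (hcont : ContinuousAt f (a + b))
    (hpos : 0 < f (a + b) ∨ 0 < ∫ u in a..(a + b), f u) :
    ∃ g > 0, HasDerivAt (fun t => (firstDeficit lam q c b f).real (Set.Ico (-t) 0)) g a := by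
  have := isFiniteMeasure_discountedExp hlam hq
  have := isFiniteMeasure_discountedStep (f := f) hlam hq
  set R := occupation c b (discountedStep lam q f) with hR
  have : IsFiniteMeasure R := isFiniteMeasure_occupation (discountedStep_univ_lt_one hlam hq)
  set M := preClaim c b (discountedExp lam q) R
  have : IsFiniteMeasure M := isFiniteMeasure_preClaim _ _
  -- The term `n = 0` of the occupation measure is the Dirac mass at the initial surplus `0`.
  have hR0 : R {0} ≠ 0 := by
    rw [hR, occupation_eq]
    simp
  have hC : R Set.univ * (ENNReal.ofReal lam * ENNReal.ofReal |c⁻¹|) ≠ ⊤ := by finiteness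
  have hMC := preClaim_restrict_le (b := b) hlam hq hc R
  have hMb := ae_preClaim_le (c := c) (b := b) (discountedExp lam q) R
  refine ⟨deficitDensity f M a, deficitDensity_pos ha hb hf h0 hMb hC hMC
    (preClaim_singleton_pos hlam hq hc hb hR0) (absolutelyContinuous_preClaim hlam hq hc hR0)
    hpos, ?_⟩
  have hint := fun t (ht : 0 ≤ t) => nextLevel_real_Ico (c := c) (b := b)
    (η := discountedExp lam q) (R := R) hf h0 ht
  have hderiv := intervalIntegral.integral_hasDerivAt_right (hint a ha.le).1
    (measurable_deficitDensity hf M).stronglyMeasurable.stronglyMeasurableAtFilter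
    (continuousAt_deficitDensity hf h0 hMb hC hMC (by linarith) hcont)
  refine hderiv.congr_of_eventuallyEq ?_
  filter_upwards [lt_mem_nhds ha] with t ht
  exact (hint t ht.le).2

/-- For a finite measure `Q`, the partial first moment `∫_{[-t,0)} -z dQ` changes with `t` like `a`
times the mass `Q [-t, 0)` near `t = a`. -/
lemma abs_sub_sub_mul_le {Q : Measure ℝ} [IsFiniteMeasure Q] {s t : ℝ} (hs : 0 ≤ s) (hst : s ≤ t)
    {a : ℝ} (ha : a = s ∨ a = t) :
    |(∫ z in Set.Ico (-t) 0, -z ∂Q) - (∫ z in Set.Ico (-s) 0, -z ∂Q) -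
      a * (Q.real (Set.Ico (-t) 0) - Q.real (Set.Ico (-s) 0))| ≤
      (t - s) * (Q.real (Set.Ico (-t) 0) - Q.real (Set.Ico (-s) 0)) := by
  have hint : ∀ A : Set ℝ, MeasurableSet A → A ⊆ Set.Ico (-t) 0 →
      IntegrableOn (fun z => -z) A Q := by
    intro A hA hAt
    refine Integrable.of_bound (by fun_prop) t ?_
    filter_upwards [ae_restrict_mem hA] with z hz
    have := hAt hz
    rw [norm_neg, Real.norm_eq_abs, abs_le]
    constructor <;> linarith [this.1, this.2]
  have hsplit : Set.Ico (-t) (-s) ∪ Set.Ico (-s) 0 = Set.Ico (-t) 0 :=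
    Set.Ico_union_Ico_eq_Ico (by linarith) (by linarith)
  have hdisj : Disjoint (Set.Ico (-t) (-s)) (Set.Ico (-s) 0) :=
    Set.disjoint_left.2 fun z h1 h2 => not_le.2 h1.2 h2.1
  have h1 : ∫ z in Set.Ico (-t) 0, -z ∂Q =
      (∫ z in Set.Ico (-t) (-s), -z ∂Q) + ∫ z in Set.Ico (-s) 0, -z ∂Q := by
    rw [← hsplit, setIntegral_union hdisj measurableSet_Ico
      (hint _ measurableSet_Ico (hsplit ▸ Set.subset_union_left))
      (hint _ measurableSet_Ico (hsplit ▸ Set.subset_union_right))]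
  have h2 : Q.real (Set.Ico (-t) 0) = Q.real (Set.Ico (-t) (-s)) + Q.real (Set.Ico (-s) 0) := by
    rw [← hsplit, measureReal_union hdisj measurableSet_Ico]
  have h3 : (∫ z in Set.Ico (-t) (-s), -z ∂Q) - a * Q.real (Set.Ico (-t) (-s)) =
      ∫ z in Set.Ico (-t) (-s), (-z - a) ∂Q := by
    rw [integral_sub (hint _ measurableSet_Ico (hsplit ▸ Set.subset_union_left))
      (integrable_const _)]
    simp [mul_comm]
  rw [h1, h2, add_sub_cancel_right, add_sub_cancel_right, h3, ← Real.norm_eq_abs]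
  refine norm_setIntegral_le_of_norm_le_const (measure_lt_top _ _) fun z hz => ?_
  rw [Real.norm_eq_abs, abs_le]
  rcases ha with rfl | rfl <;> constructor <;> linarith [hz.1, hz.2]

lemma hasDerivAt_firstMoment {Q : Measure ℝ} [IsFiniteMeasure Q] {a g : ℝ} (ha : 0 < a)
    (hQ : HasDerivAt (fun t => Q.real (Set.Ico (-t) 0)) g a) :
    HasDerivAt (fun t => ∫ z in Set.Ico (-t) 0, -z ∂Q) (a * g) a := by
  -- `B - a G` has derivative `0`: its increment is at most `|t - a| |G t - G a|`.
  set G := fun t => Q.real (Set.Ico (-t) 0) with hG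
  set B := fun t => ∫ z in Set.Ico (-t) 0, -z ∂Q with hB
  have hrem : HasDerivAt (fun t => B t - a * G t) 0 a := by
    rw [hasDerivAt_iff_isLittleO]
    have hlim : Tendsto (fun t => G t - G a) (𝓝 a) (𝓝 0) := by
      simpa using (hQ.continuousAt.tendsto.sub_const (G a))
    have ho : (fun t => (t - a) * (G t - G a)) =o[𝓝 a] fun t => (t - a) := by
      simpa using (Asymptotics.isBigO_refl (fun t => t - a) (𝓝 a)).mul_isLittleO
        ((Asymptotics.isLittleO_one_iff ℝ).2 hlim)
    refine Asymptotics.IsBigO.trans_isLittleO (.of_bound 1 ?_) ho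
    filter_upwards [lt_mem_nhds ha] with t ht
    rw [smul_zero, sub_zero, one_mul, Real.norm_eq_abs, Real.norm_eq_abs]
    rcases le_total a t with h | h
    · refine le_trans (le_of_eq ?_) ((abs_sub_sub_mul_le (Q := Q) ha.le h (.inl rfl)).trans
        (le_abs_self _))
      congr 1
      simp only [hB, hG]
      ring
    · refine le_trans (le_of_eq ?_) ((abs_sub_sub_mul_le (Q := Q) ht.le h (.inr rfl)).trans
        (le_trans (le_of_eq ?_) (le_abs_self _)))
      · rw [abs_sub_comm]
        congr 1
        simp only [hB, hG]
        ring
      · simp only [hG]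
        ring
  have h := hrem.add (hQ.const_mul a)
  rw [zero_add] at h
  refine h.congr_of_eventuallyEq (.of_forall fun t => ?_)
  simp [hG]

/-- The derivative of the value at `0` in the threshold `a` is the density of the first deficit at
`a`, times the gain from covering a deficit of size `a` instead of declaring bankruptcy. -/
lemma exists_hasDerivAt_J [IsProbabilityMeasure μ] (hCL : IsCramerLundberg μ lam f w xi)
    (hq : 0 < q) (hc : 0 < c) (ha : 0 < a) (hb : 0 ≤ b) (hcont : ContinuousAt f (a + b))
    (hpos : 0 < f (a + b) ∨ 0 < ∫ u in a..(a + b), f u) :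
    ∃ r > 0, HasDerivAt (fun t => J μ w xi q c k P t b 0)
      (r * (J μ w xi q c k P a b 0 - (k * a - P))) a := by
  have := isProbabilityMeasure_claimLaw hCL
  have := isFiniteMeasure_firstDeficit (f := f) (c := c) (b := b) hCL.lam_pos hq
  obtain ⟨g, hg, hG⟩ := exists_hasDerivAt_firstDeficit hCL.lam_pos hq hc ha hb
    hCL.measurable_density hCL.density_nonneg hcont hpos
  have hlt := fun t => firstDeficit_real_Ico_lt_one (f := f) (c := c) (b := b) hCL.lam_pos hq t
  have hB := hasDerivAt_firstMoment ha hG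
  have hne : 1 - (firstDeficit lam q c b f).real (Set.Ico (-a) 0) ≠ 0 := by linarith [hlt a]
  set S := ∫ x, firstDividends μ w xi q c b x ∂(occupation c b (discountedStep lam q f))
  have hnum := (((hasDerivAt_const a S).sub (hB.const_mul k)).sub
    ((hG.const_sub ((firstDeficit lam q c b f).real (Set.Iio 0))).const_mul P))
  have hquot := hnum.div (hG.const_sub 1) hne
  refine ⟨g / (1 - (firstDeficit lam q c b f).real (Set.Ico (-a) 0)),
    div_pos hg (by linarith [hlt a]), ?_⟩
  have hJ := hquot.congr_of_eventuallyEq (f₁ := fun t => J μ w xi q c k P t b 0) (by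
    filter_upwards [lt_mem_nhds ha] with t ht
    have hnet : 1 - (firstDeficit lam q c b f).real (Set.Ico (-t) 0) ≠ 0 := by linarith [hlt t]
    exact eq_div_of_mul_eq hnet (J_zero_eq hCL hq hc hb ht))
  convert! hJ using 1
  have hJa := J_zero_eq (k := k) (P := P) hCL hq hc hb ha
  simp only [Pi.sub_apply]
  rw [← hJa]
  field_simp
  ring

end Derivative

end BufferPolicy

theorem mainTheorem2 {Ω : Type*} [MeasurableSpace Ω] (μ : Measure Ω) [IsProbabilityMeasure μ]
    (lam : ℝ) (f : ℝ → ℝ) (w xi : ℕ → Ω → ℝ) (hCL : IsCramerLundberg μ lam f w xi)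
    (q c k P a b : ℝ) (hq : 0 < q) (hc : 0 < c) (hk : 1 ≤ k) (ha : 0 < a) (hb : 0 ≤ b)
    (hcont : ContinuousAt f (a + b))
    (hpos : 0 < f (a + b) ∨ 0 < ∫ u in a..(a + b), f u) :
    (∀ x : ℝ, Integrable
      (fun ω => BufferPolicy.profit q c k P a b x (fun n => w n ω) (fun n => xi n ω)) μ) ∧
    DifferentiableAt ℝ (fun a' => BufferPolicy.J μ w xi q c k P a' b 0) a ∧
    (deriv (fun a' => BufferPolicy.J μ w xi q c k P a' b 0) a = 0 ↔
      BufferPolicy.J μ w xi q c k P a b 0 = k * a - P) ∧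
    (BufferPolicy.J μ w xi q c k P a b 0 = k * a - P ↔
      BufferPolicy.J μ w xi q c k P a b (-a) = -P) := by
  obtain ⟨r, hr, hJ⟩ := BufferPolicy.exists_hasDerivAt_J (k := k) (P := P) hCL hq hc ha hb hcont
    hpos
  refine ⟨BufferPolicy.integrable_profit hCL hq hc hb ha, hJ.differentiableAt, ?_, ?_⟩
  · rw [hJ.deriv, mul_eq_zero, or_iff_right hr.ne', sub_eq_zero]
  · rw [BufferPolicy.J_of_mem_Ico (x := -a) hCL hq hc hb ha ⟨le_rfl, by linarith⟩]
    constructor <;> intro h <;> linarith
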